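/- Let $0<\lambda\le L<\infty$, let $B_r\subset\mathbb R^2$ be the open disc of radius $r$ centred at $0$, and let $A\in M(\lambda,L)$, i.e. $A:\mathbb R^2\to\mathbb R^{2\times 2}$ is a symmetric matrix field with measurable coefficients such that $\lambda|\xi|^2\le A(x)\xi\cdot\xi\le L|\xi|^2$ for every $\xi\in\mathbb R^2$ and almost every $x\in\mathbb R^2$. Let $m\ge 2$ and let $u_1,\dots,u_m\in H^1(B_1)$ be nonnegative continuous functions on $B_1$ such that, for every $i$, $$-\operatorname{div}(A\nabla u_i)\le 0\quad\text{in } B_1$$ in the weak sense, i.e. $\int_{B_1}A\nabla u_i\cdot\nabla\varphi\,dx\le 0$ for every $0\le\varphi\in C_c^\infty(B_1)$. Assume that the positivity sets $\{u_i>0\}$ are pairwise disjoint and that $u_i(0)=0$ for every $i=1,\dots,m$. Then the map $$\Phi(r):=\prod_{i=1}^m\frac{1}{r^{2k^*_m}}\int_{B_r}A\nabla u_i\cdot\nabla u_i\,dx,\qquad k^*_m:=\frac m2\sqrt{\frac{\lambda}{L}},$$ is monotone non-decreasing in $r$ for $r\in(0,1)$. -/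

import Mathlib

open MeasureTheory Set
open scoped ContDiff

/-- The pairing `M ξ · ζ` on `ℝⁿ`. -/
noncomputable def matPairing {n : ℕ} (M : Matrix (Fin n) (Fin n) ℝ)
    (ξ ζ : EuclideanSpace ℝ (Fin n)) : ℝ :=
  inner ℝ (Matrix.toEuclideanLin M ξ) ζ

/-- The class `M(lam, L)` of symmetric matrix fields on `ℝⁿ` with (Lebesgue) measurable
coefficients such that `lam |ξ|² ≤ A(x) ξ · ξ ≤ L |ξ|²` for all `ξ` and almost every `x`.
Boundedness of the coefficients is a consequence of symmetry and of the two inequalities. -/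
structure MemEllipticClass {n : ℕ} (lam L : ℝ)
    (A : EuclideanSpace ℝ (Fin n) → Matrix (Fin n) (Fin n) ℝ) : Prop where
  aemeasurable : ∀ i j, AEMeasurable (fun x => A x i j) volume
  symm : ∀ᵐ x, (A x).IsSymm
  lower : ∀ᵐ x, ∀ ξ, lam * ‖ξ‖ ^ 2 ≤ matPairing (A x) ξ ξ
  upper : ∀ᵐ x, ∀ ξ, matPairing (A x) ξ ξ ≤ L * ‖ξ‖ ^ 2

/-- `φ ∈ C_c^∞(Ω)`. -/
structure IsTestFunction {n : ℕ} (Ω : Set (EuclideanSpace ℝ (Fin n)))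
    (φ : EuclideanSpace ℝ (Fin n) → ℝ) : Prop where
  smooth : ContDiff ℝ ∞ φ
  compact : HasCompactSupport φ
  supp : tsupport φ ⊆ Ω

/-- `u ∈ H¹(Ω)` and `G` is (a representative of) its weak gradient `∇u` in `Ω`. -/
structure MemH1WithGradient {n : ℕ} (Ω : Set (EuclideanSpace ℝ (Fin n)))
    (u : EuclideanSpace ℝ (Fin n) → ℝ)
    (G : EuclideanSpace ℝ (Fin n) → EuclideanSpace ℝ (Fin n)) : Prop where
  memLp : MemLp u 2 (volume.restrict Ω)
  memLp_grad : MemLp G 2 (volume.restrict Ω)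
  weak : ∀ φ, IsTestFunction Ω φ → ∀ v,
    ∫ x in Ω, u x * fderiv ℝ φ x v = - ∫ x in Ω, inner ℝ (G x) v * φ x

/-- `-div(A ∇u) ≤ 0` in `Ω` in the weak sense, where `G` is the weak gradient of `u`. -/
def IsWeakSubsolution {n : ℕ} (A : EuclideanSpace ℝ (Fin n) → Matrix (Fin n) (Fin n) ℝ)
    (Ω : Set (EuclideanSpace ℝ (Fin n)))
    (G : EuclideanSpace ℝ (Fin n) → EuclideanSpace ℝ (Fin n)) : Prop :=
  ∀ φ, IsTestFunction Ω φ → (∀ x, 0 ≤ φ x) →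
    ∫ x in Ω, matPairing (A x) (G x) (gradient φ x) ≤ 0

/-- The exponent `k*_m = (m / 2) √(lam / L)`. -/
noncomputable def acfExponent (m : ℕ) (lam L : ℝ) : ℝ := (m : ℝ) / 2 * √(lam / L)

/-- `Φ(r) = ∏ᵢ r^{-2 k*_m} ∫_{B_r} A ∇uᵢ · ∇uᵢ dx`, where `G i` is the weak gradient of `uᵢ`. -/
noncomputable def acfFunctional {n m : ℕ} (lam L : ℝ)
    (A : EuclideanSpace ℝ (Fin n) → Matrix (Fin n) (Fin n) ℝ)
    (G : Fin m → EuclideanSpace ℝ (Fin n) → EuclideanSpace ℝ (Fin n)) (r : ℝ) : ℝ :=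
  ∏ i, 1 / r ^ (2 * acfExponent m lam L) *
    ∫ x in Metric.ball 0 r, matPairing (A x) (G i x) (G i x)

/-!
The energy `D(r) = ∫_{B_r} A ∇u · ∇u` of one of the functions has, for almost every `r`, the
derivative `∫_{∂B_r} A ∇u · ∇u`, and testing the weak inequality with `u` times a radial cutoff
gives `D(r) ≤ ∫_{∂B_r} u (A ∇u · n)` for almost every `r`
(`MemH1WithGradient.ae_integral_ball_le_integralOnCircle`). If `n` and `τ` are the unit normal and
tangent of the circle, ellipticity and symmetry give
`A ∇u · ∇u ≥ (A ∇u · n)² / L + lam (∇u · τ)²` (`conormal_sq_add_tangential_sq_le`).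
On almost every circle `u` is absolutely continuous with tangential derivative `∇u · τ`
(`MemH1WithGradient.ae_circle_sub_eq_integral`). If `u` vanishes somewhere on the circle, and is
positive on a set of angles of measure `l`, Wirtinger's inequality
(`Function.Periodic.mul_integral_sq_le_integral_sq`) bounds `∫ (∇u · τ)²` from below by
`(π / (l r))² ∫ u²`, and with Young's inequality `D' ≥ 2 √(lam / L) π / (l r) D`
(`ae_mul_energy_le_integralOnCircle`).

The positivity sets are disjoint, so `∑ lᵢ ≤ 2 π` and `∑ π / lᵢ ≥ m² / 2` by the Cauchy-Schwarz
inequality. Hence `∑ Dᵢ' / Dᵢ ≥ m² √(lam / L) / r`, which says that the logarithmic derivative of `Φ`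
is nonnegative. All quantities are absolutely continuous in `r`, so `Φ` is monotone
(`prod_div_rpow_le_of_le_sum_div`). Each `uᵢ` has a zero on the circles that matter because
`m ≥ 2`: if all energies are positive, another of the functions is positive at some point of the
circle.

Traces on circles are obtained by mollification. Where `u` is smooth everything is classical, and
the mollified gradients converge in `L²`, hence along a subsequence in `L¹` of almost every circle.
-/

open Filter Topology
open scoped Convolution ENNReal

/-! ### Absolutely continuous functions and the Wirtinger inequality -/

theorem LipschitzOnWith.comp_absolutelyContinuousOnInterval {φ f : ℝ → ℝ} {s : Set ℝ}
    {K : NNReal} {a b : ℝ} (hφ : LipschitzOnWith K φ s) (hf : AbsolutelyContinuousOnInterval f a b)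
    (hs : MapsTo f (uIcc a b) s) : AbsolutelyContinuousOnInterval (fun x => φ (f x)) a b := by
  rw [absolutelyContinuousOnInterval_iff] at hf ⊢
  intro ε hε
  obtain ⟨δ, hδ, H⟩ := hf (ε / (K + 1)) (by positivity)
  refine ⟨δ, hδ, fun I hI hlen => ?_⟩
  calc ∑ i ∈ Finset.range I.1, dist (φ (f (I.2 i).1)) (φ (f (I.2 i).2))
      ≤ ∑ i ∈ Finset.range I.1, K * dist (f (I.2 i).1) (f (I.2 i).2) :=
        Finset.sum_le_sum fun i hi => hφ.dist_le_mul _ (hs (hI.1 i hi).1) _ (hs (hI.1 i hi).2)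
    _ = K * ∑ i ∈ Finset.range I.1, dist (f (I.2 i).1) (f (I.2 i).2) :=
        (Finset.mul_sum _ _ _).symm
    _ ≤ K * (ε / (K + 1)) := by gcongr; exact (H I hI hlen).le
    _ < (K + 1) * (ε / (K + 1)) := by gcongr; linarith
    _ = ε := by field

/-- A `C¹` function of an absolutely continuous function with values in a compact interval is
absolutely continuous. -/
theorem ContDiffOn.comp_absolutelyContinuousOnInterval {φ f : ℝ → ℝ} {a b c d : ℝ}
    (hφ : ContDiffOn ℝ 1 φ (Icc c d)) (hf : AbsolutelyContinuousOnInterval f a b)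
    (hs : MapsTo f (uIcc a b) (Icc c d)) :
    AbsolutelyContinuousOnInterval (fun x => φ (f x)) a b := by
  obtain ⟨K, hK⟩ := hφ.exists_lipschitzOnWith (by decide) (convex_Icc _ _) isCompact_Icc
  exact hK.comp_absolutelyContinuousOnInterval hf hs

theorem AbsolutelyContinuousOnInterval.congr {f g : ℝ → ℝ} {a b : ℝ}
    (hf : AbsolutelyContinuousOnInterval f a b) (h : EqOn f g (uIcc a b)) :
    AbsolutelyContinuousOnInterval g a b := by
  rw [absolutelyContinuousOnInterval_iff] at hf ⊢
  intro ε hε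
  obtain ⟨δ, hδ, H⟩ := hf ε hε
  refine ⟨δ, hδ, fun I hI hlen => ?_⟩
  convert H I hI hlen using 1
  exact Finset.sum_congr rfl fun i hi => by rw [h (hI.1 i hi).1, h (hI.1 i hi).2]

/-- **Wirtinger's inequality on the positivity set**, with a constant below the optimal one. The
length that enters is that of the set where `w` does not vanish, not that of the interval.

Let `σ x` be the measure of `{w ≠ 0} ∩ [a, x]` and `T = tan (κ (σ - l / 2))`, which is smooth in `σ`
because `κ l < π`. Then `T' = κ (1 + T²)` on `{w ≠ 0}`, so `g² - κ² w² + κ (w² T)' = (g + κ w T)²`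
almost everywhere, and `w² T` vanishes at both ends. No decomposition of `{w ≠ 0}` into intervals is
needed. -/
theorem mul_integral_sq_le_integral_sq_of_mul_lt_pi {w g : ℝ → ℝ} {a b κ : ℝ} (hab : a ≤ b)
    (hw : Continuous w) (hg : IntervalIntegrable g volume a b)
    (hg2 : IntervalIntegrable (fun x => g x ^ 2) volume a b)
    (hwg : ∀ x ∈ Icc a b, w x = ∫ t in a..x, g t) (hb : w b = 0) (hκ : 0 < κ)
    (hκl : κ * (∫ x in a..b, indicator {x | w x ≠ 0} 1 x) < Real.pi) :
    κ ^ 2 * ∫ x in a..b, w x ^ 2 ≤ ∫ x in a..b, g x ^ 2 := by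
  set S : Set ℝ := {x | w x ≠ 0} with hS
  have hSm : MeasurableSet S := (isOpen_ne_fun hw continuous_const).measurableSet
  have hχ : ∀ c d : ℝ, IntervalIntegrable (S.indicator (1 : ℝ → ℝ)) volume c d := fun c d => by
    rw [intervalIntegrable_iff]
    exact IntegrableOn.indicator (integrableOn_const (by simp [uIoc])) hSm
  set l := ∫ x in a..b, S.indicator (1 : ℝ → ℝ) x with hl
  set σ : ℝ → ℝ := fun x => ∫ t in a..x, S.indicator (1 : ℝ → ℝ) t with hσ
  have hσ0 : ∀ x ∈ Icc a b, 0 ≤ σ x := fun x hx =>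
    intervalIntegral.integral_nonneg hx.1 fun t _ => indicator_nonneg (by simp) t
  have hσl : ∀ x ∈ Icc a b, σ x ≤ l := fun x hx => by
    have h1 : σ x + ∫ t in x..b, S.indicator (1 : ℝ → ℝ) t = l :=
      intervalIntegral.integral_add_adjacent_intervals (hχ _ _) (hχ _ _)
    have h2 : 0 ≤ ∫ t in x..b, S.indicator (1 : ℝ → ℝ) t :=
      intervalIntegral.integral_nonneg hx.2 fun t _ => indicator_nonneg (by simp) t
    linarith
  set ψ : ℝ → ℝ := fun s => Real.tan (κ * (s - l / 2)) with hψ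
  have hcos : ∀ s ∈ Icc 0 l, 0 < Real.cos (κ * (s - l / 2)) := fun s hs => by
    apply Real.cos_pos_of_mem_Ioo
    constructor <;> nlinarith [hs.1, hs.2]
  have hψd : ∀ s ∈ Icc 0 l, HasDerivAt ψ (κ * (1 + ψ s ^ 2)) s := fun s hs => by
    have h1 : HasDerivAt (fun s => κ * (s - l / 2)) κ s := by
      simpa using ((hasDerivAt_id s).sub_const (l / 2)).const_mul κ
    have h2 := (Real.hasDerivAt_tan (hcos s hs).ne').comp s h1
    refine h2.congr_deriv ?_
    have := (hcos s hs).ne'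
    change _ = κ * (1 + Real.tan (κ * (s - l / 2)) ^ 2)
    generalize κ * (s - l / 2) = y at this
    rw [Real.tan_eq_sin_div_cos]
    field_simp
    linarith [Real.sin_sq_add_cos_sq y]
  have hψc : ContDiffOn ℝ 1 ψ (Icc 0 l) := fun s hs => by
    have h1 : ContDiffAt ℝ 1 (fun s => κ * (s - l / 2)) s := by fun_prop
    exact ((Real.contDiffAt_tan.2 (hcos s hs).ne').comp s h1).contDiffWithinAt
  have hu : uIcc a b = Icc a b := uIcc_of_le hab
  have hσac : AbsolutelyContinuousOnInterval σ a b :=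
    (hχ a b).absolutelyContinuousOnInterval_intervalIntegral left_mem_uIcc
  have hTac : AbsolutelyContinuousOnInterval (fun x => ψ (σ x)) a b :=
    hψc.comp_absolutelyContinuousOnInterval hσac
      (fun x hx => ⟨hσ0 x (hu ▸ hx), hσl x (hu ▸ hx)⟩)
  have hwac : AbsolutelyContinuousOnInterval w a b :=
    (hg.absolutelyContinuousOnInterval_intervalIntegral left_mem_uIcc).congr
      (fun x hx => (hwg x (hu ▸ hx)).symm)
  have hPac := (hwac.fun_mul hwac).fun_mul hTac
  have hP := hPac.integral_deriv_eq_sub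
  have hwa : w a = 0 := by simpa using hwg a (left_mem_Icc.2 hab)
  simp only [hb, hwa, mul_zero, zero_mul, sub_self] at hP
  have hint := hPac.intervalIntegrable_deriv
  have hw2 : IntervalIntegrable (fun x => w x ^ 2) volume a b :=
    (hw.pow 2).intervalIntegrable _ _
  have key : 0 ≤ ∫ x in a..b, (g x ^ 2 - κ ^ 2 * w x ^ 2
      + κ * deriv (fun x => w x * w x * ψ (σ x)) x) := by
    apply intervalIntegral.integral_nonneg_of_ae_restrict hab
    rw [EventuallyLE, ae_restrict_iff' measurableSet_Icc]
    have hne : ∀ᵐ x : ℝ, x ≠ a ∧ x ≠ b := by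
      filter_upwards [compl_mem_ae_iff.2 (measure_singleton a),
        compl_mem_ae_iff.2 (measure_singleton b)] with x h1 h2 using ⟨h1, h2⟩
    filter_upwards [hg.ae_hasDerivAt_integral, (hχ a b).ae_hasDerivAt_integral, hne]
      with x h1 h2 h3 hx
    have hxo : Ioo a b ∈ 𝓝 x :=
      Ioo_mem_nhds (lt_of_le_of_ne hx.1 h3.1.symm) (lt_of_le_of_ne hx.2 h3.2)
    have hd1 : HasDerivAt w (g x) x := by
      refine (h1 (hu.symm ▸ hx) a left_mem_uIcc).congr_of_eventuallyEq ?_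
      filter_upwards [hxo] with y hy using hwg y (Ioo_subset_Icc_self hy)
    have hd2 : HasDerivAt (fun x => ψ (σ x)) (κ * (1 + ψ (σ x) ^ 2) * S.indicator 1 x) x :=
      (hψd _ ⟨hσ0 x hx, hσl x hx⟩).comp x (h2 (hu.symm ▸ hx) a left_mem_uIcc)
    have hd := ((hd1.mul hd1).mul hd2).deriv
    have hd' : deriv (fun x => w x * w x * ψ (σ x)) x = _ := hd
    rw [hd']
    -- Off `S` both `w` and its contribution to the derivative vanish.
    by_cases hxS : w x = 0
    · simp [hxS]; positivity
    · have : S.indicator (1 : ℝ → ℝ) x = 1 := indicator_of_mem (show x ∈ S from hxS) _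
      simp only [this, Pi.zero_apply, Pi.mul_apply]
      nlinarith [sq_nonneg (g x + κ * w x * ψ (σ x))]
  rw [intervalIntegral.integral_add (hg2.sub (hw2.const_mul _)) (hint.const_mul _),
    intervalIntegral.integral_sub hg2 (hw2.const_mul _), intervalIntegral.integral_const_mul,
    intervalIntegral.integral_const_mul, hP] at key
  linarith

/-- **Wirtinger's inequality on the circle** for a function with a zero: the best constant is that
of an interval as long as the set where `w` does not vanish. -/
theorem Function.Periodic.mul_integral_sq_le_integral_sq {w g : ℝ → ℝ} {l : ℝ}
    (hwp : Function.Periodic w (2 * Real.pi)) (hgp : Function.Periodic g (2 * Real.pi))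
    (hw : Continuous w) (hg : IntervalIntegrable g volume (-Real.pi) Real.pi)
    (hg2 : IntervalIntegrable (fun x => g x ^ 2) volume (-Real.pi) Real.pi)
    (hwg : ∀ x ∈ Icc (-Real.pi) Real.pi, w x - w (-Real.pi) = ∫ t in (-Real.pi)..x, g t)
    {θ₀ : ℝ} (h0 : w θ₀ = 0)
    (hl : l = ∫ x in (-Real.pi)..Real.pi, indicator {x | w x ≠ 0} 1 x) (hlpos : 0 < l) :
    (Real.pi / l) ^ 2 * ∫ x in (-Real.pi)..Real.pi, w x ^ 2 ≤
      ∫ x in (-Real.pi)..Real.pi, g x ^ 2 := by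
  have hpi := Real.pi_pos
  have hshift : ∀ {f : ℝ → ℝ}, Function.Periodic f (2 * Real.pi) →
      ∫ x in (-Real.pi)..Real.pi, f x = ∫ x in θ₀..(θ₀ + 2 * Real.pi), f x := fun hf => by
    rw [← hf.intervalIntegral_add_eq (-Real.pi) θ₀]; congr 1; ring
  have hii : ∀ {f : ℝ → ℝ}, Function.Periodic f (2 * Real.pi) →
      IntervalIntegrable f volume (-Real.pi) Real.pi → ∀ a b, IntervalIntegrable f volume a b :=
    fun hf hfi a b => hf.intervalIntegrable (t := -Real.pi) (by positivity)
      (by convert hfi using 1; ring) a b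
  have hg2p : Function.Periodic (fun x => g x ^ 2) (2 * Real.pi) := fun x => by simp only [hgp x]
  have hw2p : Function.Periodic (fun x => w x ^ 2) (2 * Real.pi) := fun x => by simp only [hwp x]
  have hχp : Function.Periodic (indicator {x | w x ≠ 0} (1 : ℝ → ℝ)) (2 * Real.pi) := fun x => by
    simp only [indicator_apply, mem_ofPred_eq, hwp x, Pi.one_apply]
  -- The fundamental theorem of calculus extends from one period to the whole line.
  have hW : ∀ x, w x - w (-Real.pi) - ∫ t in (-Real.pi)..x, g t = 0 := by
    have hper : Function.Periodic (fun x => w x - w (-Real.pi) - ∫ t in (-Real.pi)..x, g t)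
        (2 * Real.pi) := fun x => by
      have h1 : (∫ t in (-Real.pi)..x, g t) + ∫ t in x..(x + 2 * Real.pi), g t
          = ∫ t in (-Real.pi)..(x + 2 * Real.pi), g t :=
        intervalIntegral.integral_add_adjacent_intervals (hii hgp hg _ _) (hii hgp hg _ _)
      have h2 := hgp.intervalIntegral_add_eq x (-Real.pi)
      have h3 := hwg Real.pi ⟨by linarith, le_rfl⟩
      have h4 : w Real.pi = w (-Real.pi) := by
        rw [← hwp (-Real.pi)]; congr 1; ring
      rw [show -Real.pi + 2 * Real.pi = Real.pi by ring, ← h3, h4] at h2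
      simp only [hwp x]
      linarith
    intro x
    obtain ⟨y, hy, hxy⟩ := hper.exists_mem_Ico (by positivity) x (-Real.pi)
    rw [show -Real.pi + 2 * Real.pi = Real.pi by ring] at hy
    exact hxy.trans (sub_eq_zero.2 (hwg y (Ico_subset_Icc_self hy)))
  have hlow : ∀ κ, 0 < κ → κ < Real.pi / l →
      κ ^ 2 * ∫ x in (-Real.pi)..Real.pi, w x ^ 2 ≤ ∫ x in (-Real.pi)..Real.pi, g x ^ 2 := by
    intro κ hκ hκl
    rw [hshift hg2p, hshift hw2p]
    refine mul_integral_sq_le_integral_sq_of_mul_lt_pi (by linarith) hw (hii hgp hg _ _)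
      (hii hg2p hg2 _ _) (fun x _ => ?_) (by rw [hwp, h0]) hκ ?_
    · rw [← intervalIntegral.integral_interval_sub_left (hii hgp hg (-Real.pi) x)
        (hii hgp hg (-Real.pi) θ₀)]
      linarith [hW x, hW θ₀]
    · rw [← hshift hχp, ← hl]
      rwa [lt_div_iff₀ hlpos] at hκl
  have hcont : Tendsto (fun κ : ℝ => κ ^ 2 * ∫ x in (-Real.pi)..Real.pi, w x ^ 2)
      (𝓝[<] (Real.pi / l)) (𝓝 ((Real.pi / l) ^ 2 * ∫ x in (-Real.pi)..Real.pi, w x ^ 2)) :=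
    ((by fun_prop : Continuous fun κ : ℝ =>
      κ ^ 2 * ∫ x in (-Real.pi)..Real.pi, w x ^ 2).tendsto _).mono_left nhdsWithin_le_nhds
  refine le_of_tendsto hcont ?_
  filter_upwards [Ioo_mem_nhdsLT (show 0 < Real.pi / l by positivity)] with κ hκ
    using hlow κ hκ.1 hκ.2

/-! ### Monotonicity from a logarithmic differential inequality -/

theorem AbsolutelyContinuousOnInterval.finset_sum {ι : Type*} {f : ι → ℝ → ℝ} {a b : ℝ}
    (s : Finset ι) (hf : ∀ i ∈ s, AbsolutelyContinuousOnInterval (f i) a b) :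
    AbsolutelyContinuousOnInterval (fun x => ∑ i ∈ s, f i x) a b := by
  classical
  induction s using Finset.induction_on with
  | empty =>
    simpa using ((LipschitzWith.const (0 : ℝ)).lipschitzOnWith
      (s := uIcc a b)).absolutelyContinuousOnInterval
  | insert i s hi ih =>
    simp only [Finset.sum_insert hi]
    exact (hf i (Finset.mem_insert_self i s)).fun_add
      (ih fun j hj => hf j (Finset.mem_insert_of_mem hj))

/-- If `Dᵢ(r) = ∫₀ʳ fᵢ > 0` on `[a, b]` and `∑ Dᵢ' / Dᵢ ≥ N c / r` almost everywhere, with `N` the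
number of factors, then `∏ Dᵢ / r ^ c` does not decrease from `a` to `b`. -/
theorem prod_div_rpow_le_of_le_sum_div {ι : Type*} [Fintype ι] {f : ι → ℝ → ℝ} {a b c : ℝ}
    (ha : 0 < a) (hab : a ≤ b) (hf : ∀ i, IntervalIntegrable (f i) volume 0 b)
    (hf0 : ∀ i, ∀ᵐ x, x ∈ Icc a b → 0 ≤ f i x) (hpos : ∀ i, 0 < ∫ t in (0)..a, f i t)
    (h : ∀ᵐ x, x ∈ Icc a b →
      Fintype.card ι * c / x ≤ ∑ i, f i x / ∫ t in (0)..x, f i t) :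
    ∏ i, 1 / a ^ c * ∫ t in (0)..a, f i t ≤ ∏ i, 1 / b ^ c * ∫ t in (0)..b, f i t := by
  have hb : 0 < b := ha.trans_le hab
  have hu : uIcc a b = Icc a b := uIcc_of_le hab
  have hsub : Icc a b ⊆ uIcc 0 b := by
    rw [uIcc_of_le hb.le]; exact Icc_subset_Icc_left ha.le
  have hii : ∀ i, ∀ x ∈ Icc a b, ∀ y ∈ Icc a b, IntervalIntegrable (f i) volume x y :=
    fun i x hx y hy => (hf i).mono_set (uIcc_subset_uIcc (hsub hx) (hsub hy))
  have hii0 : ∀ i, ∀ x ∈ Icc a b, IntervalIntegrable (f i) volume 0 x :=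
    fun i x hx => (hf i).mono_set (uIcc_subset_uIcc left_mem_uIcc (hsub hx))
  set D : ι → ℝ → ℝ := fun i x => ∫ t in (0)..x, f i t with hD
  have hmono : ∀ i, ∀ x ∈ Icc a b, ∀ y ∈ Icc a b, x ≤ y → D i x ≤ D i y := by
    intro i x hx y hy hxy
    have h1 : D i x + ∫ t in x..y, f i t = D i y :=
      intervalIntegral.integral_add_adjacent_intervals (hii0 i x hx) (hii i x hx y hy)
    have h2 : 0 ≤ ∫ t in x..y, f i t := by
      apply intervalIntegral.integral_nonneg_of_ae_restrict hxy
      rw [EventuallyLE, ae_restrict_iff' measurableSet_Icc]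
      filter_upwards [hf0 i] with t ht htm using ht ⟨hx.1.trans htm.1, htm.2.trans hy.2⟩
    linarith
  have hal : a ∈ Icc a b := left_mem_Icc.2 hab
  have hbr : b ∈ Icc a b := right_mem_Icc.2 hab
  have hDpos : ∀ i, ∀ x ∈ Icc a b, 0 < D i x := fun i x hx =>
    (hpos i).trans_le (hmono i a hal x hx hx.1)
  have hlogc : ∀ {p q : ℝ}, 0 < p → ContDiffOn ℝ 1 Real.log (Icc p q) := fun hp x hx =>
    (Real.contDiffAt_log.2 (hp.trans_le hx.1).ne').contDiffWithinAt
  have hDac : ∀ i, AbsolutelyContinuousOnInterval (D i) a b := fun i =>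
    ((hf i).absolutelyContinuousOnInterval_intervalIntegral left_mem_uIcc).mono (hu ▸ hsub)
  have hDlog : ∀ i, AbsolutelyContinuousOnInterval (fun x => Real.log (D i x)) a b := fun i =>
    (hlogc (hpos i) (q := D i b)).comp_absolutelyContinuousOnInterval (hDac i) fun x hx =>
      ⟨hmono i a hal x (hu ▸ hx) (hu ▸ hx).1, hmono i x (hu ▸ hx) b hbr (hu ▸ hx).2⟩
  have hlog : AbsolutelyContinuousOnInterval (fun x => Real.log x) a b :=
    (hu ▸ hlogc ha : ContDiffOn ℝ 1 Real.log (uIcc a b)).absolutelyContinuousOnInterval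
  have hFac := (AbsolutelyContinuousOnInterval.finset_sum Finset.univ fun i _ => hDlog i).fun_sub
    (hlog.const_mul (Fintype.card ι * c))
  have hF := hFac.integral_deriv_eq_sub
  have hnn : 0 ≤ ∫ x in a..b, deriv
      (fun x => (∑ i, Real.log (D i x)) - Fintype.card ι * c * Real.log x) x := by
    apply intervalIntegral.integral_nonneg_of_ae_restrict hab
    rw [EventuallyLE, ae_restrict_iff' measurableSet_Icc]
    have hda : ∀ᵐ x, ∀ i, x ∈ uIcc 0 b → ∀ c ∈ uIcc 0 b,
        HasDerivAt (fun x => ∫ t in c..x, f i t) (f i x) x :=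
      ae_all_iff.2 fun i => (hf i).ae_hasDerivAt_integral
    filter_upwards [hda, h] with x hx1 hx2 hx
    have hx0 : x ≠ 0 := (ha.trans_le hx.1).ne'
    have hd : HasDerivAt (fun x => (∑ i, Real.log (D i x)) - Fintype.card ι * c * Real.log x)
        ((∑ i, f i x / D i x) - Fintype.card ι * c * x⁻¹) x :=
      (HasDerivAt.fun_sum fun i _ =>
        (hx1 i (hsub hx) 0 left_mem_uIcc).log (hDpos i x hx).ne').sub
        ((Real.hasDerivAt_log hx0).const_mul _)
    rw [hd.deriv]
    have := hx2 hx
    rw [div_eq_mul_inv] at this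
    exact sub_nonneg.2 this
  rw [hF] at hnn
  have hexp : ∀ x ∈ Icc a b, ∏ i, 1 / x ^ c * D i x =
      Real.exp ((∑ i, Real.log (D i x)) - Fintype.card ι * c * Real.log x) := by
    intro x hx
    have hx0 : 0 < x := ha.trans_le hx.1
    rw [Finset.prod_mul_distrib, Finset.prod_const, Real.exp_sub, Real.exp_sum,
      Finset.prod_congr rfl fun i _ => Real.exp_log (hDpos i x hx), Finset.card_univ,
      show Fintype.card ι * c * Real.log x = Fintype.card ι * (Real.log x * c) by ring,
      Real.exp_nat_mul, ← Real.rpow_def_of_pos hx0, one_div, inv_pow, div_eq_inv_mul]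
  change ∏ i, 1 / a ^ c * D i a ≤ ∏ i, 1 / b ^ c * D i b
  rw [hexp a hal, hexp b hbr]
  exact Real.exp_le_exp.2 (by linarith)

/-! ### Polar coordinates in the plane -/

/-- The Euclidean plane. -/
abbrev Plane : Type := EuclideanSpace ℝ (Fin 2)

namespace Plane

/-- The unit outward normal of centred circles at the angle `θ`. -/
noncomputable def radial (θ : ℝ) : Plane := !₂[Real.cos θ, Real.sin θ]

/-- The unit tangent of centred circles at the angle `θ`. -/
noncomputable def tangent (θ : ℝ) : Plane := !₂[-Real.sin θ, Real.cos θ]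

theorem norm_radial (θ : ℝ) : ‖radial θ‖ = 1 := by
  simp [radial, EuclideanSpace.norm_eq, Fin.sum_univ_two]

theorem norm_tangent (θ : ℝ) : ‖tangent θ‖ = 1 := by
  simp [tangent, EuclideanSpace.norm_eq, Fin.sum_univ_two]

theorem inner_radial_tangent (θ : ℝ) : inner ℝ (radial θ) (tangent θ) = 0 := by
  simp [radial, tangent, PiLp.inner_apply, Fin.sum_univ_two]
  ring

theorem continuous_radial : Continuous radial := by
  unfold radial; fun_prop

theorem continuous_tangent : Continuous tangent := by
  unfold tangent; fun_prop

theorem hasDerivAt_radial (θ : ℝ) : HasDerivAt radial (tangent θ) θ := by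
  have h := ((Real.hasDerivAt_cos θ).smul_const (!₂[1, 0] : Plane)).fun_add
    ((Real.hasDerivAt_sin θ).smul_const (!₂[0, 1] : Plane))
  have h1 : radial = fun θ => Real.cos θ • (!₂[1, 0] : Plane) + Real.sin θ • !₂[0, 1] := by
    funext θ; ext i; fin_cases i <;> simp [radial]
  rw [h1]
  refine h.congr_deriv ?_
  ext i; fin_cases i <;> simp [tangent]

theorem radial_periodic : Function.Periodic radial (2 * Real.pi) := fun θ => by
  simp [radial]

theorem tangent_periodic : Function.Periodic tangent (2 * Real.pi) := fun θ => by
  simp [tangent]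

theorem norm_smul_radial {r : ℝ} (hr : 0 ≤ r) (θ : ℝ) : ‖r • radial θ‖ = r := by
  rw [norm_smul, norm_radial, mul_one, Real.norm_of_nonneg hr]

theorem continuous_polar : Continuous fun p : ℝ × ℝ => p.1 • radial p.2 :=
  continuous_fst.smul (continuous_radial.comp continuous_snd)

/-- Polar coordinates carry the measure `r dr dθ` to Lebesgue measure. -/
theorem measurePreserving_polar :
    MeasurePreserving (fun p : ℝ × ℝ => p.1 • radial p.2)
      (((volume.restrict (Ioi 0)).prod (volume.restrict (Ioo (-Real.pi) Real.pi))).withDensity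
        fun p => ENNReal.ofReal p.1) volume := by
  have hmeas : Measurable fun p : ℝ × ℝ => ENNReal.ofReal p.1 := by fun_prop
  let e : ℝ × ℝ ≃ᵐ Plane :=
    (MeasurableEquiv.finTwoArrow (α := ℝ)).symm.trans (MeasurableEquiv.toLp 2 (Fin 2 → ℝ))
  have he : MeasurePreserving e volume volume :=
    (volume_preserving_finTwoArrow ℝ).symm.trans
      (EuclideanSpace.volume_preserving_symm_measurableEquiv_toLp (Fin 2)).symm
  refine ⟨continuous_polar.measurable, ?_⟩
  ext s hs
  rw [Measure.map_apply continuous_polar.measurable hs,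
    withDensity_apply _ (continuous_polar.measurable hs), Measure.prod_restrict,
    ← he.measure_preimage hs.nullMeasurableSet, ← lintegral_indicator_one (e.measurable hs),
    ← lintegral_comp_polarCoord_symm, ← lintegral_indicator (continuous_polar.measurable hs)]
  refine lintegral_congr fun p => ?_
  have hp : e (polarCoord.symm p) = p.1 • radial p.2 := by
    ext i; fin_cases i <;> simp [e, radial, MeasurableEquiv.finTwoArrow]
  by_cases h : p.1 • radial p.2 ∈ s
  · rw [indicator_of_mem (show p ∈ (fun p : ℝ × ℝ => p.1 • radial p.2) ⁻¹' s from h),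
      indicator_of_mem (by rwa [mem_preimage, hp])]
    simp
  · rw [indicator_of_notMem (show p ∉ (fun p : ℝ × ℝ => p.1 • radial p.2) ⁻¹' s from h),
      indicator_of_notMem (by rwa [mem_preimage, hp])]
    simp

theorem ae_ae_polar {p : Plane → Prop} (h : ∀ᵐ x, p x) :
    ∀ᵐ r : ℝ, 0 < r → ∀ᵐ θ, θ ∈ Ioo (-Real.pi) Real.pi → p (r • radial θ) := by
  have h1 := measurePreserving_polar.quasiMeasurePreserving.ae h
  rw [ae_withDensity_iff (by fun_prop)] at h1
  have h2 := Measure.ae_ae_of_ae_prod h1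
  rw [ae_restrict_iff' measurableSet_Ioi] at h2
  filter_upwards [h2] with r hr hr0
  rw [← ae_restrict_iff' measurableSet_Ioo]
  filter_upwards [hr hr0] with θ hθ using hθ (by simpa using hr0)

variable {F : Plane → ℝ}

theorem integrable_polar (hF : Integrable F) :
    Integrable (fun p : ℝ × ℝ => p.1 * F (p.1 • radial p.2))
      ((volume.restrict (Ioi 0)).prod (volume.restrict (Ioo (-Real.pi) Real.pi))) := by
  have h1 := (measurePreserving_polar.integrable_comp hF.aestronglyMeasurable).2 hF
  rw [integrable_withDensity_iff_integrable_smul' (by fun_prop) (by simp)] at h1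
  refine h1.congr ?_
  rw [Measure.prod_restrict, EventuallyEq, ae_restrict_iff' (measurableSet_Ioi.prod measurableSet_Ioo)]
  filter_upwards with p hp
  simp [ENNReal.toReal_ofReal (le_of_lt hp.1)]

/-- The integral of `F` over the circle of radius `r`, with respect to arc length. -/
noncomputable def integralOnCircle (F : Plane → ℝ) (r : ℝ) : ℝ :=
  ∫ θ in (-Real.pi)..Real.pi, r * F (r • radial θ)

theorem integralOnCircle_eq (F : Plane → ℝ) (r : ℝ) :
    integralOnCircle F r = ∫ θ in Ioo (-Real.pi) Real.pi, r * F (r • radial θ) := by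
  rw [integralOnCircle, intervalIntegral.integral_of_le (by linarith [Real.pi_pos]),
    integral_Ioc_eq_integral_Ioo]

theorem integrableOn_integralOnCircle (hF : Integrable F) :
    IntegrableOn (integralOnCircle F) (Ioi 0) := by
  have := (integrable_polar hF).integral_prod_left
  simp only [← integralOnCircle_eq] at this
  exact this

theorem integral_eq_integralOnCircle (hF : Integrable F) :
    ∫ x, F x = ∫ r in Ioi 0, integralOnCircle F r := by
  have h := integral_prod _ (integrable_polar hF)
  simp only [← integralOnCircle_eq] at h
  rw [← h, ← measurePreserving_polar.map_eq, integral_map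
    continuous_polar.measurable.aemeasurable (by
      rw [measurePreserving_polar.map_eq]; exact hF.aestronglyMeasurable),
    integral_withDensity_eq_integral_toReal_smul (by fun_prop) (by simp)]
  rw [Measure.prod_restrict]
  refine setIntegral_congr_fun (measurableSet_Ioi.prod measurableSet_Ioo) fun p hp => ?_
  simp [ENNReal.toReal_ofReal (le_of_lt hp.1)]

theorem ae_intervalIntegrable_polar (hF : Integrable F) :
    ∀ᵐ r : ℝ, 0 < r →
      IntervalIntegrable (fun θ => F (r • radial θ)) volume (-Real.pi) Real.pi := by
  have h := (integrable_polar hF).prod_right_ae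
  rw [ae_restrict_iff' measurableSet_Ioi] at h
  filter_upwards [h] with r hr hr0
  rw [intervalIntegrable_iff, uIoc_of_le (by linarith [Real.pi_pos]),
    integrableOn_Ioc_iff_integrableOn_Ioo]
  refine ((hr hr0).const_mul r⁻¹).congr (.of_forall fun θ => ?_)
  have : r ≠ 0 := ne_of_gt hr0
  simp only
  field_simp

theorem integral_ball_eq_integralOnCircle {R ρ : ℝ} (hF : IntegrableOn F (Metric.ball 0 R))
    (h0 : 0 ≤ ρ) (hρ : ρ ≤ R) :
    ∫ x in Metric.ball 0 ρ, F x = ∫ r in (0)..ρ, integralOnCircle F r := by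
  have hi : Integrable ((Metric.ball (0 : Plane) ρ).indicator F) :=
    (hF.mono_set (Metric.ball_subset_ball hρ)).integrable_indicator measurableSet_ball
  rw [← integral_indicator measurableSet_ball, integral_eq_integralOnCircle hi,
    intervalIntegral.integral_of_le h0, integral_Ioc_eq_integral_Ioo,
    ← Ioi_inter_Iio, ← setIntegral_indicator measurableSet_Iio]
  refine setIntegral_congr_fun measurableSet_Ioi fun r hr => ?_
  by_cases hrρ : r < ρ
  · rw [indicator_of_mem (show r ∈ Iio ρ from hrρ)]
    simp only [integralOnCircle]
    congr 1; ext θ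
    rw [indicator_of_mem]
    rwa [mem_ball_zero_iff, norm_smul_radial (le_of_lt hr)]
  · rw [indicator_of_notMem (show r ∉ Iio ρ from hrρ)]
    simp only [integralOnCircle]
    refine (intervalIntegral.integral_congr fun θ _ => ?_).trans intervalIntegral.integral_zero
    change r * (Metric.ball (0 : Plane) ρ).indicator F (r • radial θ) = 0
    rw [indicator_of_notMem, mul_zero]
    rwa [mem_ball_zero_iff, norm_smul_radial (le_of_lt hr)]

end Plane

/-! ### Mollification in `L²` -/


section Mollification

variable {E F : Type*} [NormedAddCommGroup E] [InnerProductSpace ℝ E] [FiniteDimensional ℝ E]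
  [MeasurableSpace E] [BorelSpace E] [NormedAddCommGroup F]

/-- Translations act continuously on `L²`. -/
theorem MeasureTheory.MemLp.tendsto_eLpNorm_translate_sub {f : E → F} (hf : MemLp f 2 volume) :
    Tendsto (fun t => eLpNorm (fun x => f (x - t) - f x) 2 volume) (𝓝 0) (𝓝 0) := by
  let g : C(E, C(E, E)) := ContinuousMap.curry ⟨fun p : E × E => p.2 - p.1, by fun_prop⟩
  have hg : ∀ t, MeasurePreserving (g t) volume volume := fun t =>
    measurePreserving_sub_right volume t
  have hc : Continuous fun t => Lp.compMeasurePreserving (g t) (hg t) (hf.toLp f) :=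
    continuous_const.compMeasurePreservingLp g.continuous hg (by simp)
  have h1 := (hc.tendsto 0)
  rw [tendsto_iff_edist_tendsto_0] at h1
  refine h1.congr fun t => ?_
  rw [Lp.edist_def]
  refine eLpNorm_congr_ae ?_
  have h2 : ∀ t, Lp.compMeasurePreserving (g t) (hg t) (hf.toLp f) =ᵐ[volume]
      fun x => f (x - t) := fun t => by
    refine (Lp.coeFn_compMeasurePreserving (hf.toLp f) (hg t)).trans ?_
    exact (hg t).quasiMeasurePreserving.ae_eq hf.coeFn_toLp
  filter_upwards [h2 t, h2 0] with x hx1 hx2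
  rw [Pi.sub_apply, hx1, hx2, sub_zero]

variable [NormedSpace ℝ F] [CompleteSpace F]

/-- Jensen's inequality: the `L²` distance of a mollification is an average of the `L²` distances
of translations. -/
theorem eLpNorm_normed_convolution_sub_sq_le {f : E → F} (hf : MemLp f 2 volume)
    (φ : ContDiffBump (0 : E)) :
    eLpNorm (fun x => (φ.normed volume ⋆[ContinuousLinearMap.lsmul ℝ ℝ, volume] f) x - f x)
        2 volume ^ 2 ≤
      ∫⁻ t, ENNReal.ofReal (φ.normed volume t) *
        eLpNorm (fun x => f (x - t) - f x) 2 volume ^ 2 := by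
  have hloc : LocallyIntegrable f volume := hf.locallyIntegrable (by simp)
  have hsq : ∀ h : E → F, eLpNorm h 2 volume ^ 2 = ∫⁻ x, ‖h x‖ₑ ^ 2 := fun h => by
    have := eLpNorm_nnreal_pow_eq_lintegral (f := h) (μ := volume) (p := 2) (by simp)
    simpa using this
  have hρm : Measurable fun t => ENNReal.ofReal (φ.normed volume t) :=
    (φ.continuous_normed.measurable).ennreal_ofReal
  have hρ1 : ∫⁻ t, ENNReal.ofReal (φ.normed volume t) = 1 := by
    rw [← ofReal_integral_eq_lintegral_ofReal φ.integrable_normed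
      (.of_forall φ.nonneg_normed), φ.integral_normed, ENNReal.ofReal_one]
  have hm : AEMeasurable (fun p : E × E => ‖f (p.1 - p.2) - f p.1‖ₑ) (volume.prod volume) := by
    refine AEStronglyMeasurable.enorm (.sub ?_ ?_)
    · exact hf.1.comp_quasiMeasurePreserving (quasiMeasurePreserving_sub_of_right_invariant _ _)
    · exact hf.1.comp_fst
  have hpt : ∀ᵐ x, ‖(φ.normed volume ⋆[ContinuousLinearMap.lsmul ℝ ℝ, volume] f) x - f x‖ₑ ^ 2 ≤
      ∫⁻ t, ENNReal.ofReal (φ.normed volume t) * ‖f (x - t) - f x‖ₑ ^ 2 := by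
    refine .of_forall fun x => ?_
    have hmx : AEMeasurable (fun t => ‖f (x - t) - f x‖ₑ) volume :=
      ((hf.1.comp_quasiMeasurePreserving
        (quasiMeasurePreserving_sub_left_of_right_invariant volume x)).sub
        aestronglyMeasurable_const).enorm
    have hconv : Integrable fun t => φ.normed volume t • f (x - t) :=
      (φ.hasCompactSupport_normed.convolutionExists_left (ContinuousLinearMap.lsmul ℝ ℝ)
        φ.continuous_normed hloc x).integrable
    have h1 : (φ.normed volume ⋆[ContinuousLinearMap.lsmul ℝ ℝ, volume] f) x - f x =
        ∫ t, φ.normed volume t • (f (x - t) - f x) := by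
      simp only [smul_sub]
      rw [integral_sub hconv (φ.integrable_normed.smul_const _), integral_smul_const,
        φ.integral_normed, one_smul]
      rfl
    have h2 : ‖(φ.normed volume ⋆[ContinuousLinearMap.lsmul ℝ ℝ, volume] f) x - f x‖ₑ ≤
        ∫⁻ t, ENNReal.ofReal (φ.normed volume t) * ‖f (x - t) - f x‖ₑ := by
      rw [h1]
      refine (enorm_integral_le_lintegral_enorm _).trans_eq (lintegral_congr fun t => ?_)
      rw [enorm_smul, Real.enorm_of_nonneg (φ.nonneg_normed t)]
    have hd : ∀ h : E → ℝ≥0∞, AEMeasurable h volume →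
        ∫⁻ t, h t ∂(volume.withDensity fun t => ENNReal.ofReal (φ.normed volume t)) =
          ∫⁻ t, ENNReal.ofReal (φ.normed volume t) * h t := fun h hh => by
      rw [lintegral_withDensity_eq_lintegral_mul₀ hρm.aemeasurable hh]
      rfl
    have hhold := ENNReal.lintegral_mul_le_Lp_mul_Lq
      (volume.withDensity fun t => ENNReal.ofReal (φ.normed volume t))
      (Real.HolderConjugate.two_two) (f := fun t => ‖f (x - t) - f x‖ₑ) (g := fun _ => 1)
      (hmx.mono_ac (withDensity_absolutelyContinuous _ _)) aemeasurable_const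
    simp only [Pi.mul_apply, mul_one, ENNReal.rpow_ofNat] at hhold
    rw [hd _ hmx, hd _ (hmx.pow_const 2), hd _ aemeasurable_const] at hhold
    simp only [one_pow, mul_one, hρ1, ENNReal.one_rpow] at hhold
    refine (pow_le_pow_left₀ zero_le (h2.trans hhold) 2).trans_eq ?_
    rw [← ENNReal.rpow_ofNat, ← ENNReal.rpow_mul]
    norm_num
  calc _ = ∫⁻ x, ‖(φ.normed volume ⋆[ContinuousLinearMap.lsmul ℝ ℝ, volume] f) x - f x‖ₑ ^ 2 :=
        hsq _
    _ ≤ ∫⁻ x, ∫⁻ t, ENNReal.ofReal (φ.normed volume t) * ‖f (x - t) - f x‖ₑ ^ 2 :=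
        lintegral_mono_ae hpt
    _ = ∫⁻ t, ∫⁻ x, ENNReal.ofReal (φ.normed volume t) * ‖f (x - t) - f x‖ₑ ^ 2 := by
        rw [lintegral_lintegral_swap]
        exact ((hρm.comp measurable_snd).aemeasurable).mul (hm.pow_const 2)
    _ = _ := by
        refine lintegral_congr fun t => ?_
        rw [hsq, lintegral_const_mul' _ _ ENNReal.ofReal_ne_top]

/-- Mollifications of a square integrable function converge to it in `L²`. -/
theorem tendsto_eLpNorm_normed_convolution_sub {f : E → F} (hf : MemLp f 2 volume)
    {φ : ℕ → ContDiffBump (0 : E)} (hφ : Tendsto (fun n => (φ n).rOut) atTop (𝓝 0)) :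
    Tendsto (fun n => eLpNorm (fun x =>
      ((φ n).normed volume ⋆[ContinuousLinearMap.lsmul ℝ ℝ, volume] f) x - f x) 2 volume)
      atTop (𝓝 0) := by
  rw [ENNReal.tendsto_nhds_zero]
  intro ε hε
  have h1 := hf.tendsto_eLpNorm_translate_sub
  rw [ENNReal.tendsto_nhds_zero] at h1
  obtain ⟨δ, hδ, H⟩ := Metric.eventually_nhds_iff.1 (h1 ε hε)
  filter_upwards [hφ.eventually_lt_const hδ] with n hn
  have hρ1 : ∫⁻ t, ENNReal.ofReal ((φ n).normed volume t) = 1 := by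
    rw [← ofReal_integral_eq_lintegral_ofReal (φ n).integrable_normed
      (.of_forall (φ n).nonneg_normed), (φ n).integral_normed, ENNReal.ofReal_one]
  have h2 : eLpNorm (fun x => ((φ n).normed volume ⋆[ContinuousLinearMap.lsmul ℝ ℝ, volume] f) x
      - f x) 2 volume ^ 2 ≤ ε ^ 2 := by
    refine (eLpNorm_normed_convolution_sub_sq_le hf (φ n)).trans ?_
    calc _ ≤ ∫⁻ t, ENNReal.ofReal ((φ n).normed volume t) * ε ^ 2 := by
          refine lintegral_mono fun t => ?_
          by_cases ht : t ∈ Metric.ball (0 : E) (φ n).rOut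
          · gcongr
            exact H ((Metric.mem_ball.1 ht).trans hn)
          · rw [← (φ n).support_normed_eq (μ := volume), Function.notMem_support] at ht
            simp [ht]
      _ = ε ^ 2 := by
          rw [lintegral_mul_const _ (φ n).continuous_normed.measurable.ennreal_ofReal, hρ1, one_mul]
  exact (ENNReal.pow_le_pow_left_iff two_ne_zero).1 h2

end Mollification

/-! ### Mollified Sobolev functions -/

section Inner

variable {X V : Type*} [MeasurableSpace X] {μ : Measure X} [NormedAddCommGroup V]
  [InnerProductSpace ℝ V] {f g : X → V}

theorem MeasureTheory.MemLp.integrable_inner (hf : MemLp f 2 μ) (hg : MemLp g 2 μ) :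
    Integrable (fun x => inner ℝ (f x) (g x)) μ := by
  rw [← memLp_one_iff_integrable]
  refine MemLp.of_bilin (fun a b => inner ℝ a b) 1 hf hg (hf.1.inner hg.1)
    (.of_forall fun x => ?_)
  simpa using nnnorm_inner_le_nnnorm (𝕜 := ℝ) (f x) (g x)

theorem MeasureTheory.MemLp.tendsto_integral_inner {G : ℕ → X → V} (hf : MemLp f 2 μ)
    (hg : MemLp g 2 μ) (hG : ∀ n, AEStronglyMeasurable (G n) μ)
    (hlim : Tendsto (fun n => eLpNorm (fun x => G n x - g x) 2 μ) atTop (𝓝 0)) :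
    Tendsto (fun n => ∫ x, inner ℝ (f x) (G n x) ∂μ) atTop (𝓝 (∫ x, inner ℝ (f x) (g x) ∂μ)) := by
  refine tendsto_integral_of_L1 _ (hf.integrable_inner hg).1 ?_ ?_
  · filter_upwards [hlim.eventually_lt_const zero_lt_one] with n hn
    have h1 : MemLp (fun x => G n x - g x) 2 μ := ⟨(hG n).sub hg.1, hn.trans ENNReal.one_lt_top⟩
    refine hf.integrable_inner ((h1.add hg).ae_eq (.of_forall fun x => ?_))
    simp
  · have hbound : ∀ n, ∫⁻ x, ‖inner ℝ (f x) (G n x) - inner ℝ (f x) (g x)‖ₑ ∂μ ≤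
        eLpNorm f 2 μ * eLpNorm (fun x => G n x - g x) 2 μ := fun n => by
      simp only [← inner_sub_right]
      rw [← eLpNorm_one_eq_lintegral_enorm]
      have := eLpNorm_le_eLpNorm_mul_eLpNorm_of_nnnorm (r := 1) (p := 2) (q := 2) hf.1
        ((hG n).sub hg.1) (fun a b => inner ℝ a b) 1 (.of_forall fun x => by
          simpa using nnnorm_inner_le_nnnorm (𝕜 := ℝ) (f x) (G n x - g x))
      rwa [ENNReal.coe_one, one_mul] at this
    refine tendsto_of_tendsto_of_tendsto_of_le_of_le tendsto_const_nhds ?_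
      (fun n => zero_le) hbound
    have := ENNReal.Tendsto.const_mul (a := eLpNorm f 2 μ) hlim (.inr hf.2.ne)
    simpa using this

end Inner

/-- The bump function on the scale `1 / (n + 1)`. -/
noncomputable def mollifierBump (E : Type*) [NormedAddCommGroup E] (n : ℕ) :
    ContDiffBump (0 : E) where
  rIn := 1 / ((n : ℝ) + 1) / 2
  rOut := 1 / ((n : ℝ) + 1)
  rIn_pos := by positivity
  rIn_lt_rOut := half_lt_self (by positivity)

theorem tendsto_mollifierBump_rOut (E : Type*) [NormedAddCommGroup E] :
    Tendsto (fun n => (mollifierBump E n).rOut) atTop (𝓝 0) :=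
  tendsto_one_div_add_atTop_nhds_zero_nat

section Mollify

variable {F : Type*} [NormedAddCommGroup F] [NormedSpace ℝ F]

/-- The mollification of `f`, a function on the unit disc extended by zero, on the scale
`1 / (n + 1)`. -/
noncomputable def mollify (f : Plane → F) (n : ℕ) : Plane → F :=
  (mollifierBump Plane n).normed volume ⋆[ContinuousLinearMap.lsmul ℝ ℝ, volume]
    (Metric.ball 0 1).indicator f

theorem memLp_indicator_ball {V : Type*} [NormedAddCommGroup V] {f : Plane → V}
    (hf : MemLp f 2 (volume.restrict (Metric.ball 0 1))) :
    MemLp ((Metric.ball 0 1).indicator f) 2 volume :=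
  (memLp_indicator_iff_restrict measurableSet_ball).2 hf

variable {f : Plane → F}

theorem tendsto_eLpNorm_mollify_sub [CompleteSpace F]
    (hf : MemLp f 2 (volume.restrict (Metric.ball 0 1))) :
    Tendsto (fun n => eLpNorm (fun x => mollify f n x - (Metric.ball 0 1).indicator f x) 2 volume)
      atTop (𝓝 0) :=
  tendsto_eLpNorm_normed_convolution_sub (memLp_indicator_ball hf) (tendsto_mollifierBump_rOut _)

theorem continuous_mollify (hf : MemLp f 2 (volume.restrict (Metric.ball 0 1))) (n : ℕ) :
    Continuous (mollify f n) :=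
  (mollifierBump Plane n).hasCompactSupport_normed.continuous_convolution_left _
    (mollifierBump Plane n).continuous_normed
    ((memLp_indicator_ball hf).locallyIntegrable (by simp))

theorem contDiff_mollify [CompleteSpace F] (hf : MemLp f 2 (volume.restrict (Metric.ball 0 1)))
    (n : ℕ) : ContDiff ℝ ∞ (mollify f n) :=
  (mollifierBump Plane n).hasCompactSupport_normed.contDiff_convolution_left _
    (mollifierBump Plane n).contDiff_normed
    ((memLp_indicator_ball hf).locallyIntegrable (by simp))

theorem mollify_nonneg {u : Plane → ℝ} (hu : ∀ x ∈ Metric.ball 0 1, 0 ≤ u x) (n : ℕ) (x : Plane) :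
    0 ≤ mollify u n x := by
  refine integral_nonneg fun t => ?_
  exact mul_nonneg ((mollifierBump Plane n).nonneg_normed t) (indicator_nonneg hu _)

theorem tendsto_mollify {u : Plane → ℝ} (hu : MemLp u 2 (volume.restrict (Metric.ball 0 1)))
    (hc : ContinuousOn u (Metric.ball 0 1)) {x : Plane} (hx : x ∈ Metric.ball 0 1) :
    Tendsto (fun n => mollify u n x) atTop (𝓝 (u x)) := by
  refine ContDiffBump.convolution_tendsto_right (tendsto_mollifierBump_rOut _)
    (.of_forall fun n => (memLp_indicator_ball hu).1) ?_ tendsto_const_nhds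
  have h1 : ContinuousAt ((Metric.ball 0 1).indicator u) x := by
    refine (hc.continuousAt (Metric.isOpen_ball.mem_nhds hx)).congr ?_
    filter_upwards [Metric.isOpen_ball.mem_nhds hx] with y hy using (indicator_of_mem hy u).symm
  have h2 : Tendsto ((Metric.ball 0 1).indicator u) (𝓝 x) (𝓝 (u x)) := by
    rw [← indicator_of_mem hx u]; exact h1
  exact h2.comp tendsto_snd

/-- Away from the boundary the gradient of the mollification is the mollified weak gradient. -/
theorem fderiv_mollify {u : Plane → ℝ} {G : Plane → Plane}
    (hu : MemH1WithGradient (Metric.ball 0 1) u G) {n : ℕ} {x : Plane}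
    (hx : ‖x‖ + 1 / ((n : ℝ) + 1) < 1) (v : Plane) :
    fderiv ℝ (mollify u n) x v = inner ℝ (mollify G n x) v := by
  set ρ := (mollifierBump Plane n).normed volume with hρ
  have hρc : HasCompactSupport ρ := (mollifierBump Plane n).hasCompactSupport_normed
  have hρs : ContDiff ℝ ∞ ρ := (mollifierBump Plane n).contDiff_normed
  have hρd : Differentiable ℝ ρ := hρs.differentiable (by simp)
  have hloc : LocallyIntegrable ((Metric.ball 0 1).indicator u) volume :=
    (memLp_indicator_ball hu.memLp).locallyIntegrable (by simp)
  have hlocG : LocallyIntegrable ((Metric.ball 0 1).indicator G) volume :=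
    (memLp_indicator_ball hu.memLp_grad).locallyIntegrable (by simp)
  have hflip : mollify u n = (Metric.ball 0 1).indicator u
      ⋆[(ContinuousLinearMap.lsmul ℝ ℝ).flip, volume] ρ := (convolution_flip _).symm
  have hd := hρc.hasFDerivAt_convolution_right (ContinuousLinearMap.lsmul ℝ ℝ).flip hloc
    (hρs.of_le (by simp)) x
  rw [← hflip] at hd
  rw [hd.fderiv, convolution_precompR_apply _ hloc (hρc.fderiv ℝ)
    (hρs.continuous_fderiv (by simp))]
  -- The kernel based at `x` is admissible in the definition of the weak gradient.
  have hφd : ∀ y, fderiv ℝ (fun y => ρ (x - y)) y v = - fderiv ℝ ρ (x - y) v := fun y => by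
    have h1 : HasFDerivAt (fun y : Plane => x - y) (-ContinuousLinearMap.id ℝ Plane) y :=
      (hasFDerivAt_id y).const_sub x
    have h2 := (hρd (x - y)).hasFDerivAt.comp y h1
    have h3 : fderiv ℝ (fun y => ρ (x - y)) y = _ := h2.fderiv
    rw [h3]; simp
  have htest : IsTestFunction (Metric.ball 0 1) fun y => ρ (x - y) := by
    have hsupp : tsupport (fun y => ρ (x - y)) ⊆ Metric.closedBall x (1 / ((n : ℝ) + 1)) := by
      refine closure_minimal (fun y hy => ?_) Metric.isClosed_closedBall
      have h1 : x - y ∈ Function.support ρ := hy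
      rw [hρ, (mollifierBump Plane n).support_normed_eq, mem_ball_zero_iff] at h1
      rw [mem_closedBall_iff_norm']
      exact h1.le
    refine ⟨hρs.comp (contDiff_const.sub contDiff_id), ?_, hsupp.trans fun y hy => ?_⟩
    · exact HasCompactSupport.of_support_subset_isCompact (isCompact_closedBall x _)
        (subset_closure.trans hsupp)
    · rw [mem_closedBall_iff_norm] at hy
      rw [mem_ball_zero_iff]
      have := norm_add_le x (y - x)
      rw [add_sub_cancel] at this
      linarith
  have hw := hu.weak _ htest v
  have h1 : ((Metric.ball 0 1).indicator u ⋆[(ContinuousLinearMap.lsmul ℝ ℝ).flip, volume]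
      fun a => fderiv ℝ ρ a v) x =
        - ∫ y in Metric.ball 0 1, u y * fderiv ℝ (fun y => ρ (x - y)) y v := by
    rw [convolution_def, ← integral_neg, ← integral_indicator measurableSet_ball]
    refine integral_congr_ae (.of_forall fun y => ?_)
    by_cases hy : y ∈ Metric.ball (0 : Plane) 1
    · simp only [indicator_of_mem hy, hφd]
      simp [mul_comm]
    · simp [indicator_of_notMem hy]
  have hint : Integrable fun y => ρ (x - y) • (Metric.ball 0 1).indicator G y :=
    ((hρc.convolutionExists_left (ContinuousLinearMap.lsmul ℝ ℝ)
      hρs.continuous hlocG x).integrable_swap)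
  have h2 : inner ℝ (mollify G n x) v = ∫ y in Metric.ball 0 1, inner ℝ (G y) v * ρ (x - y) := by
    rw [mollify, convolution_eq_swap, real_inner_comm, ← integral_indicator measurableSet_ball]
    refine (integral_inner hint v).symm.trans (integral_congr_ae (.of_forall fun y => ?_))
    by_cases hy : y ∈ Metric.ball (0 : Plane) 1
    · simp only [indicator_of_mem hy]
      rw [real_inner_smul_right, mul_comm, real_inner_comm]
    · simp [indicator_of_notMem hy]
  rw [h1, hw, neg_neg, h2]

end Mollify

/-! ### Restriction of Sobolev functions to circles -/

namespace Plane

/-- The field of unit normals of the centred circles (zero at the origin). -/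
noncomputable def normalField (x : Plane) : Plane := ‖x‖⁻¹ • x

/-- The field of unit tangents of the centred circles (zero at the origin). -/
noncomputable def tangentField (x : Plane) : Plane := ‖x‖⁻¹ • !₂[-x 1, x 0]

theorem normalField_polar {r : ℝ} (hr : 0 < r) (θ : ℝ) :
    normalField (r • radial θ) = radial θ := by
  rw [normalField, norm_smul_radial hr.le, inv_smul_smul₀ hr.ne']

theorem tangentField_polar {r : ℝ} (hr : 0 < r) (θ : ℝ) :
    tangentField (r • radial θ) = tangent θ := by
  rw [tangentField, norm_smul_radial hr.le]
  ext i; fin_cases i <;> simp [radial, tangent, hr.ne']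

theorem norm_normalField_le (x : Plane) : ‖normalField x‖ ≤ 1 := by
  rw [normalField, norm_smul, norm_inv, norm_norm]
  exact inv_mul_le_one

theorem norm_tangentField_le (x : Plane) : ‖tangentField x‖ ≤ 1 := by
  have : ‖(!₂[-x 1, x 0] : Plane)‖ = ‖x‖ := by
    simp [EuclideanSpace.norm_eq, Fin.sum_univ_two, add_comm]
  rw [tangentField, norm_smul, norm_inv, norm_norm, this]
  exact inv_mul_le_one

theorem measurable_normalField : Measurable normalField := by
  unfold normalField; fun_prop

theorem measurable_tangentField : Measurable tangentField := by
  unfold tangentField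
  exact measurable_norm.inv.smul
    (by fun_prop : Continuous fun x : Plane => (!₂[-x 1, x 0] : Plane)).measurable

end Plane

open Plane

theorem MeasureTheory.MemLp.inner_of_norm_le_one {X V : Type*} [MeasurableSpace X] {μ : Measure X}
    [NormedAddCommGroup V] [InnerProductSpace ℝ V] {f e : X → V} {p : ℝ≥0∞} (hf : MemLp f p μ)
    (he : AEStronglyMeasurable e μ) (h1 : ∀ x, ‖e x‖ ≤ 1) :
    MemLp (fun x => inner ℝ (f x) (e x)) p μ := by
  refine hf.mono (hf.1.inner he) (.of_forall fun x => ?_)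
  exact (norm_inner_le_norm _ _).trans (mul_le_of_le_one_right (norm_nonneg _) (h1 x))

/-- Along a subsequence the mollifications converge in `L¹` on almost every circle. -/
theorem exists_seq_tendsto_integralOnCircle {G : Plane → Plane}
    (hG : MemLp G 2 (volume.restrict (Metric.ball 0 1))) :
    ∃ ns : ℕ → ℕ, StrictMono ns ∧ ∀ᵐ r : ℝ, 0 < r → Tendsto (fun k => integralOnCircle
      ((Metric.ball 0 1).indicator fun x =>
        ‖mollify G (ns k) x - (Metric.ball 0 1).indicator G x‖) r) atTop (𝓝 0) := by
  set B : Set Plane := Metric.ball 0 1 with hB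
  have : IsFiniteMeasure (volume.restrict B) :=
    ⟨by rw [Measure.restrict_apply_univ]; exact measure_ball_lt_top⟩
  set K : ℕ → Plane → ℝ := fun n => B.indicator fun x => ‖mollify G n x - B.indicator G x‖ with hK
  have hGi := (memLp_indicator_ball hG).1
  have hmeas : ∀ n, AEStronglyMeasurable (fun x => mollify G n x - B.indicator G x) volume :=
    fun n => (continuous_mollify hG n).aestronglyMeasurable.sub hGi
  have hL1 : Tendsto (fun n => eLpNorm (fun x => mollify G n x - B.indicator G x) 1
      (volume.restrict B)) atTop (𝓝 0) := by
    set c : ℝ≥0∞ := volume.restrict B univ ^ (1 / (1 : ℝ≥0∞).toReal - 1 / (2 : ℝ≥0∞).toReal)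
    have h1 : ∀ n, eLpNorm (fun x => mollify G n x - B.indicator G x) 1 (volume.restrict B) ≤
        eLpNorm (fun x => mollify G n x - B.indicator G x) 2 volume * c := fun n => by
      refine (eLpNorm_le_eLpNorm_mul_rpow_measure_univ one_le_two (hmeas n).restrict).trans ?_
      exact mul_le_mul_left (eLpNorm_mono_measure _ Measure.restrict_le_self) _
    refine tendsto_of_tendsto_of_tendsto_of_le_of_le tendsto_const_nhds ?_ (fun n => zero_le) h1
    have h2 : c ≠ ⊤ := ENNReal.rpow_ne_top_of_nonneg (by norm_num) (measure_ne_top _ _)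
    have h3 := ENNReal.Tendsto.mul_const (b := c)
      (tendsto_eLpNorm_mollify_sub hG) (.inr h2)
    rwa [zero_mul] at h3
  have hKi : ∀ n, Integrable (K n) := fun n => by
    refine (IntegrableOn.integrable_indicator ?_ measurableSet_ball)
    refine Integrable.norm (Integrable.sub ?_ ?_)
    · exact ((continuous_mollify hG n).continuousOn.integrableOn_compact
        (isCompact_closedBall 0 1)).mono_set Metric.ball_subset_closedBall
    · exact (((memLp_indicator_ball hG).restrict B).integrable one_le_two)
  have hK0 : ∀ n x, 0 ≤ K n x := fun n x => indicator_nonneg (fun _ _ => norm_nonneg _) x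
  have hc0 : ∀ n, ∀ r ∈ Ioi (0 : ℝ), 0 ≤ integralOnCircle (K n) r := fun n r hr =>
    intervalIntegral.integral_nonneg (by linarith [Real.pi_pos])
      fun θ _ => mul_nonneg (le_of_lt hr) (hK0 n _)
  have hKlim : Tendsto (fun n => ∫⁻ r in Ioi 0, ‖integralOnCircle (K n) r‖ₑ) atTop (𝓝 0) := by
    refine hL1.congr fun n => ?_
    rw [eLpNorm_one_eq_lintegral_enorm, ← lintegral_indicator measurableSet_ball]
    have h1 : ∫⁻ r in Ioi 0, ‖integralOnCircle (K n) r‖ₑ =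
        ENNReal.ofReal (∫ r in Ioi 0, integralOnCircle (K n) r) := by
      rw [ofReal_integral_eq_lintegral_ofReal (integrableOn_integralOnCircle (hKi n))]
      · refine setLIntegral_congr_fun measurableSet_Ioi fun r hr => ?_
        exact Real.enorm_of_nonneg (hc0 n r hr)
      · exact (ae_restrict_iff' measurableSet_Ioi).2 (.of_forall (hc0 n))
    rw [h1, ← integral_eq_integralOnCircle (hKi n),
      ofReal_integral_eq_lintegral_ofReal (hKi n) (.of_forall (hK0 n))]
    refine lintegral_congr fun x => ?_
    by_cases hx : x ∈ B
    · simp only [hK, indicator_of_mem hx, ofReal_norm]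
      rw [indicator_of_mem (hB ▸ hx), indicator_of_mem hx]
    · simp only [hK, indicator_of_notMem hx, ENNReal.ofReal_zero]
      rw [indicator_of_notMem (hB ▸ hx)]
  have htm : TendstoInMeasure (volume.restrict (Ioi 0)) (fun n r => integralOnCircle (K n) r) atTop
      fun _ => 0 := by
    refine tendstoInMeasure_of_tendsto_eLpNorm (p := 1) one_ne_zero
      (fun n => (integrableOn_integralOnCircle (hKi n)).aestronglyMeasurable)
      aestronglyMeasurable_const ?_
    refine hKlim.congr fun n => ?_
    rw [eLpNorm_one_eq_lintegral_enorm]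
    simp
  obtain ⟨ns, hns, h⟩ := htm.exists_seq_tendsto_ae
  exact ⟨ns, hns, (ae_restrict_iff' measurableSet_Ioi).1 h⟩

/-- On almost every circle a continuous Sobolev function is absolutely continuous, and its
derivative is the tangential component of the weak gradient. -/
theorem MemH1WithGradient.ae_circle_sub_eq_integral {u : Plane → ℝ} {G : Plane → Plane}
    (hu : MemH1WithGradient (Metric.ball 0 1) u G) (hc : ContinuousOn u (Metric.ball 0 1)) :
    ∀ᵐ r : ℝ, r ∈ Ioo 0 1 → ∀ α ∈ Icc (-Real.pi) Real.pi,
      u (r • radial α) - u (r • radial (-Real.pi)) =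
        ∫ θ in (-Real.pi)..α, r * inner ℝ (G (r • radial θ)) (tangent θ) := by
  have hpi := Real.pi_pos
  obtain ⟨ns, hns, hlim⟩ := exists_seq_tendsto_integralOnCircle hu.memLp_grad
  set B : Set Plane := Metric.ball 0 1 with hB
  have : IsFiniteMeasure (volume.restrict B) :=
    ⟨by rw [Measure.restrict_apply_univ]; exact measure_ball_lt_top⟩
  have hGB : IntegrableOn (fun x => inner ℝ (G x) (tangentField x)) B :=
    (hu.memLp_grad.inner_of_norm_le_one measurable_tangentField.aestronglyMeasurable
      norm_tangentField_le).integrable one_le_two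
  have hKB : ∀ n, IntegrableOn (fun x => ‖mollify G n x - B.indicator G x‖) B := fun n => by
    refine Integrable.norm (Integrable.sub ?_ ?_)
    · exact ((continuous_mollify hu.memLp_grad n).continuousOn.integrableOn_compact
        (isCompact_closedBall 0 1)).mono_set Metric.ball_subset_closedBall
    · exact (((memLp_indicator_ball hu.memLp_grad).restrict B).integrable one_le_two)
  filter_upwards [hlim, ae_intervalIntegrable_polar (hGB.integrable_indicator measurableSet_ball),
    ae_all_iff.2 fun n => ae_intervalIntegrable_polar
      ((hKB n).integrable_indicator measurableSet_ball)] with r h1 h2 h3 hr α hα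
  have hmem : ∀ θ, r • radial θ ∈ B := fun θ => by
    rw [hB, mem_ball_zero_iff, norm_smul_radial hr.1.le]; exact hr.2
  have hsubI : uIcc (-Real.pi) α ⊆ uIcc (-Real.pi) Real.pi :=
    uIcc_subset_uIcc left_mem_uIcc (by rw [uIcc_of_le (by linarith)]; exact hα)
  have hGint : IntervalIntegrable (fun θ => r * inner ℝ (G (r • radial θ)) (tangent θ)) volume
      (-Real.pi) α := by
    refine (((h2 hr.1).congr (fun θ _ => ?_)).const_mul r).mono_set hsubI
    simp only [indicator_of_mem (hmem θ), tangentField_polar hr.1]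
  -- the identity for the mollifications
  have hsmooth : ∀ n : ℕ, r + 1 / ((n : ℝ) + 1) < 1 →
      mollify u n (r • radial α) - mollify u n (r • radial (-Real.pi)) =
        ∫ θ in (-Real.pi)..α, r * inner ℝ (mollify G n (r • radial θ)) (tangent θ) := by
    intro n hn
    have hcont : Continuous fun θ => r * inner ℝ (mollify G n (r • radial θ)) (tangent θ) :=
      continuous_const.mul (((continuous_mollify hu.memLp_grad n).comp
        (continuous_radial.const_smul r)).inner continuous_tangent)
    refine (intervalIntegral.integral_eq_sub_of_hasDerivAt (f := fun θ => mollify u n (r • radial θ))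
      (fun θ _ => ?_) (hcont.intervalIntegrable _ _)).symm
    have hd := (((contDiff_mollify hu.memLp n).differentiable (by simp))
      (r • radial θ)).hasFDerivAt.comp_hasDerivAt θ ((hasDerivAt_radial θ).const_smul r)
    refine hd.congr_deriv ?_
    rw [fderiv_mollify hu (by rwa [norm_smul_radial hr.1.le]), real_inner_smul_right]
  have hL : Tendsto (fun k => mollify u (ns k) (r • radial α)
      - mollify u (ns k) (r • radial (-Real.pi))) atTop
      (𝓝 (u (r • radial α) - u (r • radial (-Real.pi)))) :=
    ((tendsto_mollify hu.memLp hc (hmem α)).comp hns.tendsto_atTop).sub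
      ((tendsto_mollify hu.memLp hc (hmem _)).comp hns.tendsto_atTop)
  have hR : Tendsto (fun k => mollify u (ns k) (r • radial α)
      - mollify u (ns k) (r • radial (-Real.pi))) atTop
      (𝓝 (∫ θ in (-Real.pi)..α, r * inner ℝ (G (r • radial θ)) (tangent θ))) := by
    rw [tendsto_iff_norm_sub_tendsto_zero]
    refine squeeze_zero' (.of_forall fun _ => norm_nonneg _) ?_ (h1 hr.1)
    have hev : ∀ᶠ k in atTop, r + 1 / ((ns k : ℝ) + 1) < 1 := by
      have h4 : Tendsto (fun k => r + 1 / ((ns k : ℝ) + 1)) atTop (𝓝 (r + 0)) :=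
        tendsto_const_nhds.add
          (tendsto_one_div_add_atTop_nhds_zero_nat.comp hns.tendsto_atTop)
      exact h4.eventually_lt_const (by simpa using hr.2)
    filter_upwards [hev] with k hk
    have hcont : Continuous fun θ => r * inner ℝ (mollify G (ns k) (r • radial θ)) (tangent θ) :=
      continuous_const.mul (((continuous_mollify hu.memLp_grad (ns k)).comp
        (continuous_radial.const_smul r)).inner continuous_tangent)
    have hKint := (h3 (ns k) hr.1).const_mul r
    rw [hsmooth _ hk, ← intervalIntegral.integral_sub (hcont.intervalIntegrable _ _) hGint]
    refine (intervalIntegral.norm_integral_le_of_norm_le hα.1 (.of_forall fun θ _ => ?_)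
      (hKint.mono_set hsubI)).trans ?_
    · rw [indicator_of_mem (hmem θ), indicator_of_mem (hmem θ), ← mul_sub, ← inner_sub_left,
        norm_mul, Real.norm_of_nonneg hr.1.le]
      refine mul_le_mul_of_nonneg_left ((norm_inner_le_norm _ _).trans ?_) hr.1.le
      rw [norm_tangent, mul_one]
    · refine intervalIntegral.integral_mono_interval le_rfl hα.1 hα.2 (.of_forall fun θ => ?_) hKint
      exact mul_nonneg hr.1.le (indicator_nonneg (fun _ _ => norm_nonneg _) _)
  exact tendsto_nhds_unique hL hR

/-! ### The energy is bounded by the flux through almost every circle -/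

section Radial

variable {h : ℝ → ℝ} {ε c : ℝ}

theorem contDiff_comp_norm (hs : ContDiff ℝ ∞ h) (hε : 0 < ε) (h0 : ∀ s ≤ ε, h s = h 0) :
    ContDiff ℝ ∞ fun x : Plane => h ‖x‖ := by
  rw [contDiff_iff_contDiffAt]
  intro x
  by_cases hx : x = 0
  · refine (contDiffAt_const (c := h 0)).congr_of_eventuallyEq ?_
    filter_upwards [Metric.ball_mem_nhds x hε] with y hy
    rw [hx, mem_ball_zero_iff] at hy
    exact h0 _ hy.le
  · exact hs.contDiffAt.comp x (contDiffAt_norm ℝ hx)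

theorem fderiv_comp_norm (hs : ContDiff ℝ ∞ h) (hε : 0 < ε) (h0 : ∀ s ≤ ε, h s = h 0)
    (x v : Plane) :
    fderiv ℝ (fun x : Plane => h ‖x‖) x v = deriv h ‖x‖ * inner ℝ (normalField x) v := by
  by_cases hx : x = 0
  · have h1 : (fun x : Plane => h ‖x‖) =ᶠ[𝓝 x] fun _ => h 0 := by
      filter_upwards [Metric.ball_mem_nhds x hε] with y hy
      rw [hx, mem_ball_zero_iff] at hy
      exact h0 _ hy.le
    rw [h1.fderiv_eq]
    simp [hx, normalField]
  · have hx' : ‖x‖ ≠ 0 := norm_ne_zero_iff.2 hx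
    have h1 : HasFDerivAt (fun y : Plane => ‖y‖) (‖x‖⁻¹ • innerSL ℝ x) x := by
      have h2 := (hasStrictFDerivAt_norm_sq x).hasFDerivAt.sqrt (by positivity)
      simp only [Real.sqrt_sq (norm_nonneg _)] at h2
      refine h2.congr_fderiv ?_
      ext v
      simp
      field_simp
    have h2 := ((hs.differentiable (by simp)) ‖x‖).hasDerivAt.comp_hasFDerivAt x h1
    have h3 : fderiv ℝ (fun x : Plane => h ‖x‖) x = _ := h2.fderiv
    rw [h3]
    simp [normalField, real_inner_smul_left]

end Radial

section Flux

theorem Continuous.memLp_restrict_ball {V : Type*} [NormedAddCommGroup V] {f : Plane → V}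
    {p : ℝ≥0∞} (hf : Continuous f) : MemLp f p (volume.restrict (Metric.ball 0 1)) := by
  have : IsFiniteMeasure (volume.restrict (Metric.ball (0 : Plane) 1)) :=
    ⟨by rw [Measure.restrict_apply_univ]; exact measure_ball_lt_top⟩
  obtain ⟨C, hC⟩ := (isCompact_closedBall (0 : Plane) 1).exists_bound_of_continuousOn hf.continuousOn
  exact .of_bound hf.aestronglyMeasurable C ((ae_restrict_iff' measurableSet_ball).2
    (.of_forall fun x hx => hC x (Metric.ball_subset_closedBall hx)))

variable {u : Plane → ℝ} {G H : Plane → Plane}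

/-- The weak inequality `-div H ≤ 0` tested with the product of `u` and a radial cutoff. -/
theorem integral_cutoff_add_le_zero (hu : MemH1WithGradient (Metric.ball 0 1) u G)
    (hnonneg : ∀ x ∈ Metric.ball 0 1, 0 ≤ u x)
    (hH : MemLp H 2 (volume.restrict (Metric.ball 0 1)))
    (hsub : ∀ φ, IsTestFunction (Metric.ball 0 1) φ → (∀ x, 0 ≤ φ x) →
      ∫ x in Metric.ball 0 1, inner ℝ (H x) (gradient φ x) ≤ 0)
    {h : ℝ → ℝ} {ε c : ℝ} (hs : ContDiff ℝ ∞ h) (hε : 0 < ε) (hc : c < 1)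
    (h0 : ∀ s ≤ ε, h s = h 0) (h1 : ∀ s, c ≤ s → h s = 0) (hpos : ∀ s, 0 ≤ h s) :
    (∫ x in Metric.ball 0 1, h ‖x‖ * inner ℝ (H x) (G x)) +
      ∫ x in Metric.ball 0 1, deriv h ‖x‖ * (u x * inner ℝ (H x) (normalField x)) ≤ 0 := by
  set B : Set Plane := Metric.ball 0 1 with hB
  have hηs := contDiff_comp_norm hs hε h0
  have hdcont : Continuous (deriv h) := hs.continuous_deriv (by simp)
  have hbdd : ∀ {g : ℝ → ℝ}, Continuous g → ∃ C, ∀ x ∈ B, ‖g ‖x‖‖ ≤ C := fun {g} hg => by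
    obtain ⟨C, hC⟩ := isCompact_Icc.exists_bound_of_continuousOn (hg.continuousOn (s := Icc 0 1))
    exact ⟨C, fun x hx => hC _ ⟨norm_nonneg x, (mem_ball_zero_iff.1 hx).le⟩⟩
  have hηH : MemLp (fun x => h ‖x‖ • H x) 2 (volume.restrict B) := by
    obtain ⟨C, hC⟩ := hbdd hs.continuous
    refine hH.of_le_mul (c := C) ((hηs.continuous.aestronglyMeasurable).smul hH.1) ?_
    refine (ae_restrict_iff' measurableSet_ball).2 (.of_forall fun x hx => ?_)
    rw [norm_smul]
    exact mul_le_mul_of_nonneg_right (hC x hx) (norm_nonneg _)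
  have hHn : MemLp (fun x => inner ℝ (H x) (normalField x)) 2 (volume.restrict B) :=
    hH.inner_of_norm_le_one measurable_normalField.aestronglyMeasurable norm_normalField_le
  have hdH : MemLp (fun x => deriv h ‖x‖ * inner ℝ (H x) (normalField x)) 2
      (volume.restrict B) := by
    obtain ⟨C, hC⟩ := hbdd hdcont
    refine hHn.of_le_mul (c := C)
      ((hdcont.comp continuous_norm).aestronglyMeasurable.mul hHn.1) ?_
    refine (ae_restrict_iff' measurableSet_ball).2 (.of_forall fun x hx => ?_)
    rw [norm_mul]
    exact mul_le_mul_of_nonneg_right (hC x hx) (norm_nonneg _)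
  have hrestr : ∀ {V : Type} [NormedAddCommGroup V] [NormedSpace ℝ V] [CompleteSpace V]
      {f : Plane → V}, MemLp f 2 (volume.restrict B) →
      Tendsto (fun n => eLpNorm (fun x => mollify f n x - f x) 2 (volume.restrict B)) atTop
        (𝓝 0) := by
    intro V _ _ _ f hf
    refine tendsto_of_tendsto_of_tendsto_of_le_of_le tendsto_const_nhds
      (tendsto_eLpNorm_mollify_sub hf) (fun n => zero_le) fun n => ?_
    refine le_trans (le_of_eq ?_)
      (eLpNorm_mono_measure _ (Measure.restrict_le_self (μ := volume) (s := B)))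
    refine eLpNorm_congr_ae ((ae_restrict_iff' measurableSet_ball).2 (.of_forall fun x hx => ?_))
    simp only [indicator_of_mem (hB ▸ hx : x ∈ Metric.ball (0 : Plane) 1)]
  have hlim1 := hηH.tendsto_integral_inner hu.memLp_grad
    (fun n => (continuous_mollify hu.memLp_grad n).aestronglyMeasurable) (hrestr hu.memLp_grad)
  have hlim2 := hdH.tendsto_integral_inner hu.memLp
    (fun n => (continuous_mollify hu.memLp n).aestronglyMeasurable) (hrestr hu.memLp)
  have hlim := hlim1.add hlim2
  have e1 : ∫ x in B, inner ℝ (h ‖x‖ • H x) (G x) = ∫ x in B, h ‖x‖ * inner ℝ (H x) (G x) := by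
    simp only [real_inner_smul_left]
  have e2 : ∫ x in B, inner ℝ (deriv h ‖x‖ * inner ℝ (H x) (normalField x)) (u x) =
      ∫ x in B, deriv h ‖x‖ * (u x * inner ℝ (H x) (normalField x)) := by
    refine integral_congr_ae (.of_forall fun x => ?_)
    simp only [RCLike.inner_apply, conj_trivial]
    ring
  rw [e1, e2] at hlim
  refine le_of_tendsto hlim ?_
  have hev : ∀ᶠ n : ℕ in atTop, c + 1 / ((n : ℝ) + 1) < 1 := by
    have h4 : Tendsto (fun n : ℕ => c + 1 / ((n : ℝ) + 1)) atTop (𝓝 (c + 0)) :=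
      tendsto_const_nhds.add tendsto_one_div_add_atTop_nhds_zero_nat
    exact h4.eventually_lt_const (by simpa using hc)
  filter_upwards [hev] with n hn
  have hus := contDiff_mollify hu.memLp n
  have hsupp : tsupport (fun x : Plane => h ‖x‖ * mollify u n x) ⊆ Metric.closedBall 0 c := by
    refine closure_minimal (fun y hy => ?_) Metric.isClosed_closedBall
    rw [mem_closedBall_zero_iff]
    by_contra! hyc
    exact hy (by simp [h1 _ hyc.le])
  have htest : IsTestFunction B fun x => h ‖x‖ * mollify u n x :=
    ⟨hηs.mul hus, HasCompactSupport.of_support_subset_isCompact (isCompact_closedBall 0 c)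
      (subset_closure.trans hsupp), hsupp.trans (Metric.closedBall_subset_ball hc)⟩
  have hle := hsub _ htest fun x => mul_nonneg (hpos _) (mollify_nonneg hnonneg n x)
  have hgrad : ∀ x v, inner ℝ v (gradient (fun x => h ‖x‖ * mollify u n x) x) =
      inner ℝ (h ‖x‖ • v) (mollify G n x) +
        inner ℝ (deriv h ‖x‖ * inner ℝ v (normalField x)) (mollify u n x) := by
    intro x v
    have e3 : inner ℝ v (gradient (fun x => h ‖x‖ * mollify u n x) x) =
        fderiv ℝ (fun x => h ‖x‖ * mollify u n x) x v := by
      rw [real_inner_comm, ← toDual_gradient, InnerProductSpace.toDual_apply_apply]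
    have e4 : fderiv ℝ (fun x => h ‖x‖ * mollify u n x) x v =
        h ‖x‖ * fderiv ℝ (mollify u n) x v + mollify u n x * fderiv ℝ (fun x => h ‖x‖) x v := by
      rw [fderiv_fun_mul ((hηs.differentiable (by simp)) x) ((hus.differentiable (by simp)) x)]
      simp
    have e5 : h ‖x‖ * fderiv ℝ (mollify u n) x v = h ‖x‖ * inner ℝ (mollify G n x) v := by
      rcases le_or_gt c ‖x‖ with hxc | hxc
      · rw [h1 _ hxc, zero_mul, zero_mul]
      · rw [fderiv_mollify hu (by linarith)]
    rw [e3, e4, e5, fderiv_comp_norm hs hε h0, real_inner_smul_left, real_inner_comm v,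
      real_inner_comm v (normalField x)]
    simp only [RCLike.inner_apply, conj_trivial]
  refine le_of_eq_of_le ?_ hle
  have hmG := (continuous_mollify hu.memLp_grad n).memLp_restrict_ball (p := 2)
  have hmu := (continuous_mollify hu.memLp n).memLp_restrict_ball (p := 2)
  rw [← integral_add (hηH.integrable_inner hmG) (hdH.integrable_inner hmu)]
  exact integral_congr_ae (.of_forall fun x => (hgrad x (H x)).symm)

/-- A function on `(0, 1)` whose integrals against nonnegative test functions are nonnegative is
nonnegative almost everywhere. -/
theorem ae_nonneg_of_integral_smooth_mul_nonneg {F : ℝ → ℝ}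
    (hF : IntervalIntegrable F volume 0 1)
    (h : ∀ (ψ : ℝ → ℝ) (ε c : ℝ), ContDiff ℝ ∞ ψ → 0 < ε → c < 1 → (∀ s, 0 ≤ ψ s) →
      (∀ s, s ∉ Icc ε c → ψ s = 0) → 0 ≤ ∫ s in (0)..1, ψ s * F s) :
    ∀ᵐ r : ℝ, r ∈ Ioo 0 1 → 0 ≤ F r := by
  have hloc : LocallyIntegrable ((Ioc 0 1).indicator F) := by
    refine Integrable.locallyIntegrable ?_
    exact ((intervalIntegrable_iff_integrableOn_Ioc_of_le zero_le_one).1 hF).integrable_indicator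
      measurableSet_Ioc
  have hlim := ContDiffBump.ae_convolution_tendsto_right_of_locallyIntegrable (K := 2)
    (tendsto_mollifierBump_rOut ℝ) (.of_forall fun n => by
      simp only [mollifierBump]; linarith) hloc
  filter_upwards [hlim] with r hr hr01
  rw [indicator_of_mem (Ioo_subset_Ioc_self hr01)] at hr
  refine ge_of_tendsto hr ?_
  have hpos : 0 < min r (1 - r) := lt_min hr01.1 (by linarith [hr01.2])
  filter_upwards [(tendsto_mollifierBump_rOut ℝ).eventually_lt_const hpos] with n hn
  have hn1 := hn.trans_le (min_le_left _ _)
  have hn2 := hn.trans_le (min_le_right _ _)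
  set φ := mollifierBump ℝ n
  have := h (fun s => φ.normed volume (r - s)) (r - φ.rOut) (r + φ.rOut)
    (φ.contDiff_normed.comp (contDiff_const.sub contDiff_id)) (by linarith) (by linarith)
    (fun s => φ.nonneg_normed _) fun s hs => by
      have h1 : r - s ∉ Function.support (φ.normed volume) := by
        rw [φ.support_normed_eq, Real.ball_eq_Ioo]
        intro h2
        exact hs ⟨by linarith [h2.2], by linarith [h2.1]⟩
      simpa using h1
  rw [convolution_lsmul_swap]
  rw [intervalIntegral.integral_of_le zero_le_one, ← integral_indicator measurableSet_Ioc] at this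
  refine this.trans_eq (integral_congr_ae (.of_forall fun s => ?_))
  by_cases hs : s ∈ Ioc (0 : ℝ) 1
  · simp only [indicator_of_mem hs, smul_eq_mul]
  · simp only [indicator_of_notMem hs, smul_zero]

theorem Plane.integralOnCircle_norm_mul (h : ℝ → ℝ) (F : Plane → ℝ) {r : ℝ} (hr : 0 ≤ r) :
    integralOnCircle (fun x => h ‖x‖ * F x) r = h r * integralOnCircle F r := by
  simp only [integralOnCircle, norm_smul_radial hr, ← intervalIntegral.integral_const_mul]
  refine intervalIntegral.integral_congr fun θ _ => ?_
  ring_nf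

theorem Plane.intervalIntegrable_integralOnCircle {F : Plane → ℝ}
    (hF : IntegrableOn F (Metric.ball 0 1)) :
    IntervalIntegrable (integralOnCircle F) volume 0 1 := by
  rw [intervalIntegrable_iff, uIoc_of_le zero_le_one, integrableOn_Ioc_iff_integrableOn_Ioo]
  refine ((integrableOn_integralOnCircle (hF.integrable_indicator measurableSet_ball)).mono_set
    Ioo_subset_Ioi_self).congr_fun (fun r hr => ?_) measurableSet_Ioo
  simp only [integralOnCircle]
  refine intervalIntegral.integral_congr fun θ _ => ?_
  rw [indicator_of_mem]
  rw [mem_ball_zero_iff, norm_smul_radial hr.1.le]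
  exact hr.2

theorem Plane.integral_ball_norm_mul {h : ℝ → ℝ} (hh : Continuous h) {F : Plane → ℝ}
    (hF : IntegrableOn F (Metric.ball 0 1)) :
    ∫ x in Metric.ball 0 1, h ‖x‖ * F x = ∫ r in (0)..1, h r * integralOnCircle F r := by
  have hi : IntegrableOn (fun x => h ‖x‖ * F x) (Metric.ball 0 1) := by
    obtain ⟨C, hC⟩ := isCompact_Icc.exists_bound_of_continuousOn (hh.continuousOn (s := Icc 0 1))
    refine hF.bdd_mul (c := C) (hh.comp continuous_norm).aestronglyMeasurable ?_
    exact (ae_restrict_iff' measurableSet_ball).2 (.of_forall fun x hx =>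
      hC _ ⟨norm_nonneg x, (mem_ball_zero_iff.1 hx).le⟩)
  rw [integral_ball_eq_integralOnCircle hi zero_le_one le_rfl]
  refine intervalIntegral.integral_congr fun r hr => ?_
  rw [uIcc_of_le zero_le_one] at hr
  exact integralOnCircle_norm_mul h F hr.1

/-- **The energy inequality**: through almost every centred circle the flux of `u H` is at least
the energy inside. This replaces the integration by parts `∫_{B_r} H · ∇u ≤ ∫_{∂B_r} u H · n`, which
has no classical meaning for fields of class `L²`. -/
theorem MemH1WithGradient.ae_integral_ball_le_integralOnCircle
    (hu : MemH1WithGradient (Metric.ball 0 1) u G) (hnonneg : ∀ x ∈ Metric.ball 0 1, 0 ≤ u x)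
    (hH : MemLp H 2 (volume.restrict (Metric.ball 0 1)))
    (hsub : ∀ φ, IsTestFunction (Metric.ball 0 1) φ → (∀ x, 0 ≤ φ x) →
      ∫ x in Metric.ball 0 1, inner ℝ (H x) (gradient φ x) ≤ 0) :
    ∀ᵐ r : ℝ, r ∈ Ioo 0 1 → ∫ s in (0)..r, integralOnCircle (fun x => inner ℝ (H x) (G x)) s ≤
      integralOnCircle (fun x => u x * inner ℝ (H x) (normalField x)) r := by
  have hF1 : IntegrableOn (fun x => inner ℝ (H x) (G x)) (Metric.ball 0 1) :=
    hH.integrable_inner hu.memLp_grad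
  have hF2 : IntegrableOn (fun x => u x * inner ℝ (H x) (normalField x)) (Metric.ball 0 1) := by
    have h1 : MemLp (fun x => inner ℝ (H x) (normalField x)) 2
        (volume.restrict (Metric.ball 0 1)) :=
      hH.inner_of_norm_le_one measurable_normalField.aestronglyMeasurable norm_normalField_le
    refine (h1.integrable_inner hu.memLp).congr (.of_forall fun x => ?_)
    simp only [RCLike.inner_apply, conj_trivial]
  set f := integralOnCircle (fun x => inner ℝ (H x) (G x))
  set q := integralOnCircle (fun x => u x * inner ℝ (H x) (normalField x))
  have hfi : IntervalIntegrable f volume 0 1 := intervalIntegrable_integralOnCircle hF1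
  have hqi : IntervalIntegrable q volume 0 1 := intervalIntegrable_integralOnCircle hF2
  have hDac := hfi.absolutelyContinuousOnInterval_intervalIntegral (c := 0) left_mem_uIcc
  have hDi : IntervalIntegrable (fun r => ∫ s in (0)..r, f s) volume 0 1 :=
    hDac.continuousOn.intervalIntegrable
  have key := ae_nonneg_of_integral_smooth_mul_nonneg (hqi.sub hDi) ?_
  · filter_upwards [key] with r hr hr01 using sub_nonneg.1 (hr hr01)
  intro ψ ε c hψ hε hc hψ0 hsupp
  -- The cutoff is the primitive of `-ψ` that vanishes at `1`.
  set h : ℝ → ℝ := fun s => ∫ t in s..1, ψ t with hh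
  have hψi : ∀ a b, IntervalIntegrable ψ volume a b := fun a b => hψ.continuous.intervalIntegrable a b
  have hd : ∀ s, HasDerivAt h (-ψ s) s := fun s =>
    intervalIntegral.integral_hasDerivAt_left (hψi _ _)
      (hψ.continuous.stronglyMeasurableAtFilter _ _) hψ.continuous.continuousAt
  have hderiv : deriv h = fun s => -ψ s := funext fun s => (hd s).deriv
  have hs : ContDiff ℝ ∞ h := by
    rw [contDiff_infty_iff_deriv, hderiv]
    exact ⟨fun s => (hd s).differentiableAt, hψ.neg⟩
  have hzero : ∀ a b, (∀ t ∈ uIcc a b, ψ t = 0) → ∫ t in a..b, ψ t = 0 := fun a b hab =>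
    (intervalIntegral.integral_congr hab).trans intervalIntegral.integral_zero
  have h0 : ∀ s ≤ ε / 2, h s = h 0 := fun s hsε => by
    have h2 : (∫ t in s..0, ψ t) + ∫ t in (0)..1, ψ t = h s :=
      intervalIntegral.integral_add_adjacent_intervals (hψi _ _) (hψi _ _)
    rw [← h2, hzero s 0 fun t ht => hsupp t fun ht' => ?_, zero_add]
    have h3 : t ≤ ε / 2 := ht.2.trans (max_le hsε (by linarith))
    linarith [ht'.1]
  have h1 : ∀ s, (c + 1) / 2 ≤ s → h s = 0 := fun s hsc =>
    hzero s 1 fun t ht => hsupp t fun ht' => by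
      have h3 : (c + 1) / 2 ≤ t := (le_min hsc (by linarith)).trans ht.1
      linarith [ht'.2]
  have hpos : ∀ s, 0 ≤ h s := fun s => by
    rcases le_total s 1 with hs1 | hs1
    · exact intervalIntegral.integral_nonneg hs1 fun t _ => hψ0 t
    · exact (h1 s (by linarith)).ge
  have hmain := integral_cutoff_add_le_zero hu hnonneg hH hsub hs (half_pos hε)
    (by linarith : (c + 1) / 2 < 1) h0 h1 hpos
  rw [integral_ball_norm_mul hs.continuous hF1,
    integral_ball_norm_mul (hs.continuous_deriv (by simp)) hF2] at hmain
  have hhac : AbsolutelyContinuousOnInterval h 0 1 :=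
    (hs.of_le (by simp) : ContDiff ℝ 1 h).contDiffOn.absolutelyContinuousOnInterval
  have hparts := hhac.integral_mul_deriv_eq_deriv_mul hDac
  have hfd : ∫ x in (0)..1, h x * deriv (fun r => ∫ s in (0)..r, f s) x =
      ∫ x in (0)..1, h x * f x := by
    refine intervalIntegral.integral_congr_ae ?_
    filter_upwards [hfi.ae_hasDerivAt_integral] with x hx hx01
    rw [(hx (uIoc_subset_uIcc hx01) 0 left_mem_uIcc).deriv]
  rw [hfd, h1 1 (by linarith), intervalIntegral.integral_same] at hparts
  rw [hparts] at hmain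
  have hψq : IntervalIntegrable (fun s => ψ s * q s) volume 0 1 :=
    hqi.continuousOn_mul hψ.continuous.continuousOn
  have hψD : IntervalIntegrable (fun s => ψ s * ∫ t in (0)..s, f t) volume 0 1 :=
    hDi.continuousOn_mul hψ.continuous.continuousOn
  simp only [hderiv, neg_mul, intervalIntegral.integral_neg] at hmain
  simp only [mul_sub]
  rw [intervalIntegral.integral_sub hψq hψD]
  change _ + - ∫ s in (0)..1, ψ s * q s ≤ 0 at hmain
  linarith

end Flux

/-! ### Elliptic matrices -/

section Elliptic

variable {n : ℕ} {M : Matrix (Fin n) (Fin n) ℝ} {lam L : ℝ}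

theorem matPairing_comm (hM : M.IsSymm) (ξ ζ : EuclideanSpace ℝ (Fin n)) :
    matPairing M ξ ζ = matPairing M ζ ξ := by
  have h : M.conjTranspose = M := by
    rw [Matrix.conjTranspose_eq_transpose_of_trivial]; exact hM
  have h1 := (Matrix.isSymmetric_toEuclideanLin_iff).2 h
  rw [matPairing, matPairing, h1 ξ ζ, real_inner_comm]

theorem matPairing_sub_smul_self (hM : M.IsSymm) (ξ ζ : EuclideanSpace ℝ (Fin n)) (t : ℝ) :
    matPairing M (ξ - t • ζ) (ξ - t • ζ) =
      matPairing M ξ ξ - 2 * t * matPairing M ξ ζ + t ^ 2 * matPairing M ζ ζ := by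
  have h := matPairing_comm hM ζ ξ
  simp only [matPairing, map_sub, map_smul, inner_sub_left, inner_sub_right,
    real_inner_smul_left, real_inner_smul_right] at h ⊢
  rw [h]; ring

theorem norm_toEuclideanLin_le (hM : M.IsSymm) (hlam : 0 < lam) (hL : lam ≤ L)
    (hlow : ∀ ξ, lam * ‖ξ‖ ^ 2 ≤ matPairing M ξ ξ) (hup : ∀ ξ, matPairing M ξ ξ ≤ L * ‖ξ‖ ^ 2)
    (ξ : EuclideanSpace ℝ (Fin n)) : ‖Matrix.toEuclideanLin M ξ‖ ≤ L * ‖ξ‖ := by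
  have hL0 : 0 < L := hlam.trans_le hL
  set ζ := Matrix.toEuclideanLin M ξ with hζ
  have h1 : matPairing M ξ ζ = ‖ζ‖ ^ 2 := real_inner_self_eq_norm_sq ζ
  have h2 := matPairing_sub_smul_self hM ξ ζ L⁻¹
  have h3 : 0 ≤ matPairing M (ξ - L⁻¹ • ζ) (ξ - L⁻¹ • ζ) :=
    le_trans (by positivity) (hlow _)
  rw [h2, h1] at h3
  have h4 : L⁻¹ ^ 2 * matPairing M ζ ζ ≤ L⁻¹ * ‖ζ‖ ^ 2 := by
    calc L⁻¹ ^ 2 * matPairing M ζ ζ ≤ L⁻¹ ^ 2 * (L * ‖ζ‖ ^ 2) := by gcongr; exact hup ζ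
      _ = L⁻¹ * ‖ζ‖ ^ 2 := by field_simp
  have h5 : L⁻¹ * ‖ζ‖ ^ 2 ≤ L * ‖ξ‖ ^ 2 := by linarith [hup ξ]
  have h6 : ‖ζ‖ ^ 2 ≤ (L * ‖ξ‖) ^ 2 := by
    rw [inv_mul_le_iff₀ hL0] at h5
    linarith
  exact (sq_le_sq₀ (norm_nonneg _) (by positivity)).1 h6

/-- The energy density controls the conormal derivative and the tangential derivative. The weights
multiply to `lam / L`, and this is where the exponent `√(lam / L)` comes from. -/
theorem conormal_sq_add_tangential_sq_le (hM : M.IsSymm) (hlam : 0 < lam) (hL : lam ≤ L)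
    (hlow : ∀ ξ, lam * ‖ξ‖ ^ 2 ≤ matPairing M ξ ξ) (hup : ∀ ξ, matPairing M ξ ξ ≤ L * ‖ξ‖ ^ 2)
    {ν τ : EuclideanSpace ℝ (Fin n)} (hν : ‖ν‖ = 1) (hτ : ‖τ‖ = 1) (hντ : inner ℝ ν τ = 0)
    (ξ : EuclideanSpace ℝ (Fin n)) :
    matPairing M ξ ν ^ 2 / L + lam * inner ℝ ξ τ ^ 2 ≤ matPairing M ξ ξ := by
  have hL0 : 0 < L := hlam.trans_le hL
  set a := matPairing M ν ν
  have ha : 0 < a := by have := hlow ν; rw [hν] at this; linarith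
  have haL : a ≤ L := by have := hup ν; rw [hν] at this; linarith
  set p := matPairing M ξ ν
  -- Remove from `ξ` its component along `ν`, with respect to the pairing of `M`.
  set ζ := ξ - (p / a) • ν with hζ
  have h1 : matPairing M ζ ζ = matPairing M ξ ξ - p ^ 2 / a := by
    rw [hζ, matPairing_sub_smul_self hM]
    change _ - 2 * (p / a) * p + (p / a) ^ 2 * a = _
    field_simp
    ring
  have h2 : inner ℝ ζ τ = inner ℝ ξ τ := by
    rw [hζ, inner_sub_left, real_inner_smul_left, hντ, mul_zero, sub_zero]
  have h3 : inner ℝ ξ τ ^ 2 ≤ ‖ζ‖ ^ 2 := by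
    rw [← h2, sq_le_sq, abs_of_nonneg (norm_nonneg ζ)]
    simpa [hτ] using abs_real_inner_le_norm ζ τ
  have h4 := mul_le_mul_of_nonneg_left h3 hlam.le
  have h5 : p ^ 2 / L ≤ p ^ 2 / a := by gcongr
  linarith [hlow ζ]

end Elliptic

/-- The field `A ∇u` is square integrable. -/
theorem MemEllipticClass.memLp_toEuclideanLin {n : ℕ} {lam L : ℝ}
    {A : EuclideanSpace ℝ (Fin n) → Matrix (Fin n) (Fin n) ℝ} (hA : MemEllipticClass lam L A)
    (hlam : 0 < lam) (hL : lam ≤ L) {s : Set (EuclideanSpace ℝ (Fin n))}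
    {G : EuclideanSpace ℝ (Fin n) → EuclideanSpace ℝ (Fin n)} {p : ℝ≥0∞}
    (hG : MemLp G p (volume.restrict s)) :
    MemLp (fun x => Matrix.toEuclideanLin (A x) (G x)) p (volume.restrict s) := by
  refine hG.of_le_mul (c := L) ?_ ?_
  · have h1 : ∀ i, AEMeasurable (fun x => ∑ j, A x i j * G x j) (volume.restrict s) := fun i => by
      refine Finset.aemeasurable_fun_sum _ fun j _ => (hA.aemeasurable i j).restrict.mul ?_
      exact (by fun_prop : Continuous fun y : EuclideanSpace ℝ (Fin n) => y j).measurable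
        |>.comp_aemeasurable hG.1.aemeasurable
    have h2 : AEMeasurable (fun x => WithLp.toLp 2 fun i => ∑ j, A x i j * G x j)
        (volume.restrict s) :=
      (PiLp.continuous_toLp 2 _).measurable.comp_aemeasurable (aemeasurable_pi_lambda _ h1)
    refine h2.aestronglyMeasurable.congr (.of_forall fun x => ?_)
    ext i
    simp [Matrix.mulVec, dotProduct]
  · filter_upwards [ae_restrict_of_ae hA.symm, ae_restrict_of_ae hA.lower,
      ae_restrict_of_ae hA.upper] with x h1 h2 h3
    exact norm_toEuclideanLin_le h1 hlam hL h2 h3 _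

/-! ### The growth rate of the energy on one circle -/

/-- On a circle of radius `r` where `w` vanishes somewhere, and does not vanish on an arc of total
angle `l`, the energy is at least `2 √(lam / L) π / (l r)` times the flux: Young's inequality and
Wirtinger's inequality for the tangential derivative. -/
theorem mul_flux_le_energy {w T Q e : ℝ → ℝ} {lam L r l : ℝ} (hlam : 0 < lam) (hL : lam ≤ L)
    (hr : 0 < r) (hwp : Function.Periodic w (2 * Real.pi))
    (hTp : Function.Periodic T (2 * Real.pi)) (hw : Continuous w)
    (hT : IntervalIntegrable T volume (-Real.pi) Real.pi)
    (hT2 : IntervalIntegrable (fun θ => T θ ^ 2) volume (-Real.pi) Real.pi)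
    (he : IntervalIntegrable e volume (-Real.pi) Real.pi)
    (hwQ : IntervalIntegrable (fun θ => w θ * Q θ) volume (-Real.pi) Real.pi)
    (hwT : ∀ α ∈ Icc (-Real.pi) Real.pi, w α - w (-Real.pi) = ∫ θ in (-Real.pi)..α, r * T θ)
    (hQe : ∀ᵐ θ, θ ∈ Ioo (-Real.pi) Real.pi → Q θ ^ 2 / L + lam * T θ ^ 2 ≤ e θ)
    {θ₀ : ℝ} (h0 : w θ₀ = 0)
    (hl : l = ∫ θ in (-Real.pi)..Real.pi, indicator {θ | w θ ≠ 0} 1 θ) (hlpos : 0 < l) :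
    2 * √(lam / L) * (Real.pi / (l * r)) * ∫ θ in (-Real.pi)..Real.pi, r * (w θ * Q θ) ≤
      ∫ θ in (-Real.pi)..Real.pi, r * e θ := by
  have hL0 : 0 < L := hlam.trans_le hL
  have hpi : -Real.pi ≤ Real.pi := by linarith [Real.pi_pos]
  set k := Real.pi / (l * r) with hk
  have hW := hwp.mul_integral_sq_le_integral_sq (g := fun θ => r * T θ)
    (fun θ => by simp only [hTp θ]) hw (hT.const_mul r)
    (by simpa only [mul_pow] using hT2.const_mul (r ^ 2)) hwT h0 hl hlpos
  simp only [mul_pow, intervalIntegral.integral_const_mul] at hW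
  have hW' : k ^ 2 * ∫ θ in (-Real.pi)..Real.pi, w θ ^ 2 ≤
      ∫ θ in (-Real.pi)..Real.pi, T θ ^ 2 := by
    have h1 : k ^ 2 = (Real.pi / l) ^ 2 / r ^ 2 := by rw [hk]; field_simp
    rw [h1, div_mul_eq_mul_div, div_le_iff₀ (by positivity)]
    linarith
  have hw2 : IntervalIntegrable (fun θ => w θ ^ 2) volume (-Real.pi) Real.pi :=
    (hw.pow 2).intervalIntegrable _ _
  have hint : ∫ θ in (-Real.pi)..Real.pi, 2 * √(lam / L) * k * (w θ * Q θ) ≤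
      ∫ θ in (-Real.pi)..Real.pi, (e θ - lam * (T θ ^ 2 - k ^ 2 * w θ ^ 2)) := by
    refine intervalIntegral.integral_mono_ae_restrict hpi (hwQ.const_mul _)
      (he.sub ((hT2.sub (hw2.const_mul _)).const_mul _)) ?_
    rw [EventuallyLE, ← restrict_Ioo_eq_restrict_Icc, ae_restrict_iff' measurableSet_Ioo]
    filter_upwards [hQe] with θ hθ hmem
    have h1 := hθ hmem
    have h2 : (√(lam / L)) ^ 2 = lam / L := Real.sq_sqrt (by positivity)
    -- Young's inequality, after multiplication by `L`
    have h3 : 0 ≤ (Q θ - L * √(lam / L) * k * w θ) ^ 2 / L := by positivity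
    have h4 : (Q θ - L * √(lam / L) * k * w θ) ^ 2 / L =
        Q θ ^ 2 / L - 2 * √(lam / L) * k * (w θ * Q θ) + L * (√(lam / L)) ^ 2 * k ^ 2 * w θ ^ 2 := by
      field_simp
      ring
    have h5 : L * (lam / L) = lam := by field_simp
    rw [h4, h2, h5] at h3
    linarith
  rw [intervalIntegral.integral_const_mul, intervalIntegral.integral_sub he
    ((hT2.sub (hw2.const_mul _)).const_mul _), intervalIntegral.integral_const_mul,
    intervalIntegral.integral_sub hT2 (hw2.const_mul _), intervalIntegral.integral_const_mul] at hint
  have h6 := mul_nonneg hlam.le (sub_nonneg.2 hW')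
  rw [intervalIntegral.integral_const_mul, intervalIntegral.integral_const_mul]
  nlinarith

/-- Angles that add up to at most `2 π` have reciprocals that add up to at least `m² / (2 π)`. -/
theorem sq_card_le_sum_pi_div {ι : Type*} [Fintype ι] {l : ι → ℝ} (hl : ∀ i, 0 < l i)
    (hsum : ∑ i, l i ≤ 2 * Real.pi) [Nonempty ι] :
    (Fintype.card ι : ℝ) ^ 2 / 2 ≤ ∑ i, Real.pi / l i := by
  have hpi := Real.pi_pos
  have h1 := Finset.sq_sum_div_le_sum_sq_div Finset.univ (fun _ : ι => (1 : ℝ)) (g := l)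
    fun i _ => hl i
  simp only [Finset.sum_const, Finset.card_univ, nsmul_eq_mul, mul_one, one_pow] at h1
  have h2 : 0 < ∑ i, l i := Finset.sum_pos (fun i _ => hl i) Finset.univ_nonempty
  have h3 : (Fintype.card ι : ℝ) ^ 2 / (2 * Real.pi) ≤ (Fintype.card ι : ℝ) ^ 2 / ∑ i, l i := by
    gcongr
  calc (Fintype.card ι : ℝ) ^ 2 / 2
      = Real.pi * ((Fintype.card ι : ℝ) ^ 2 / (2 * Real.pi)) := by field_simp
    _ ≤ Real.pi * ∑ i, 1 / l i := by gcongr; exact h3.trans h1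
    _ = ∑ i, Real.pi / l i := by rw [Finset.mul_sum]; simp [div_eq_mul_inv]

theorem Plane.ae_intervalIntegrable_polar_of_integrableOn {F : Plane → ℝ}
    (hF : IntegrableOn F (Metric.ball 0 1)) :
    ∀ᵐ r : ℝ, r ∈ Ioo 0 1 →
      IntervalIntegrable (fun θ => F (r • radial θ)) volume (-Real.pi) Real.pi := by
  filter_upwards [ae_intervalIntegrable_polar (hF.integrable_indicator measurableSet_ball)]
    with r h hr
  refine (h hr.1).congr fun θ _ => ?_
  rw [indicator_of_mem]
  rw [mem_ball_zero_iff, norm_smul_radial hr.1.le]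
  exact hr.2

/-- Differential inequality for the energy of one subsolution: on almost every circle on which `u`
has a zero, the logarithmic derivative of the energy is at least `2 √(lam / L) π / (l r)`, where
`l` is the angle on which `u` does not vanish. -/
theorem ae_mul_energy_le_integralOnCircle {lam L : ℝ} (hlam : 0 < lam) (hL : lam ≤ L)
    {A : Plane → Matrix (Fin 2) (Fin 2) ℝ} (hA : MemEllipticClass lam L A) {u : Plane → ℝ}
    {G : Plane → Plane} (hu : MemH1WithGradient (Metric.ball 0 1) u G)
    (hcont : ContinuousOn u (Metric.ball 0 1)) (hnonneg : ∀ x ∈ Metric.ball 0 1, 0 ≤ u x)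
    (hsub : IsWeakSubsolution A (Metric.ball 0 1) G) :
    ∀ᵐ r : ℝ, r ∈ Ioo 0 1 →
      0 < ∫ s in (0)..r, integralOnCircle (fun x => matPairing (A x) (G x) (G x)) s →
      (∃ θ, 0 < u (r • radial θ)) ∧
      ((∃ θ, u (r • radial θ) = 0) →
        0 < ∫ θ in (-Real.pi)..Real.pi, indicator {θ | u (r • radial θ) ≠ 0} (1 : ℝ → ℝ) θ ∧
        2 * √(lam / L) * (Real.pi / ((∫ θ in (-Real.pi)..Real.pi,
          indicator {θ | u (r • radial θ) ≠ 0} (1 : ℝ → ℝ) θ) * r)) *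
          (∫ s in (0)..r, integralOnCircle (fun x => matPairing (A x) (G x) (G x)) s) ≤
        integralOnCircle (fun x => matPairing (A x) (G x) (G x)) r) := by
  have hpi : -Real.pi ≤ Real.pi := by linarith [Real.pi_pos]
  set H : Plane → Plane := fun x => Matrix.toEuclideanLin (A x) (G x) with hHdef
  have hH : MemLp H 2 (volume.restrict (Metric.ball 0 1)) :=
    hA.memLp_toEuclideanLin hlam hL hu.memLp_grad
  have hQ : MemLp (fun x => inner ℝ (H x) (normalField x)) 2 (volume.restrict (Metric.ball 0 1)) :=
    hH.inner_of_norm_le_one measurable_normalField.aestronglyMeasurable norm_normalField_le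
  have hT : MemLp (fun x => inner ℝ (G x) (tangentField x)) 2
      (volume.restrict (Metric.ball 0 1)) :=
    hu.memLp_grad.inner_of_norm_le_one measurable_tangentField.aestronglyMeasurable
      norm_tangentField_le
  have : IsFiniteMeasure (volume.restrict (Metric.ball (0 : Plane) 1)) :=
    ⟨by rw [Measure.restrict_apply_univ]; exact measure_ball_lt_top⟩
  have i1 : IntegrableOn (fun x => inner ℝ (H x) (G x)) (Metric.ball 0 1) :=
    hH.integrable_inner hu.memLp_grad
  have i2 : IntegrableOn (fun x => u x * inner ℝ (H x) (normalField x)) (Metric.ball 0 1) := by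
    refine (hQ.integrable_inner hu.memLp).congr (.of_forall fun x => ?_)
    simp only [RCLike.inner_apply, conj_trivial]
  have i3 : IntegrableOn (fun x => inner ℝ (G x) (tangentField x)) (Metric.ball 0 1) :=
    hT.integrable one_le_two
  have i4 : IntegrableOn (fun x => inner ℝ (G x) (tangentField x) ^ 2) (Metric.ball 0 1) :=
    hT.integrable_sq
  filter_upwards [hu.ae_circle_sub_eq_integral hcont,
    hu.ae_integral_ball_le_integralOnCircle hnonneg hH hsub,
    ae_intervalIntegrable_polar_of_integrableOn i1, ae_intervalIntegrable_polar_of_integrableOn i2,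
    ae_intervalIntegrable_polar_of_integrableOn i3, ae_intervalIntegrable_polar_of_integrableOn i4,
    ae_ae_polar hA.symm, ae_ae_polar hA.lower, ae_ae_polar hA.upper]
    with r h1 h2 h3 h4 h5 h6 h7 h8 h9 hr hD
  set D := ∫ s in (0)..r, integralOnCircle (fun x => matPairing (A x) (G x) (G x)) s
  have hmem : ∀ θ, r • radial θ ∈ Metric.ball (0 : Plane) 1 := fun θ => by
    rw [mem_ball_zero_iff, norm_smul_radial hr.1.le]; exact hr.2
  have hw : Continuous fun θ => u (r • radial θ) :=
    hcont.comp_continuous (continuous_radial.const_smul r) hmem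
  have hper : ∀ {V : Type} (f : Plane → V),
      Function.Periodic (fun θ => f (r • radial θ)) (2 * Real.pi) := fun f θ => by
    simp only [radial_periodic θ]
  have hq : D ≤ ∫ θ in (-Real.pi)..Real.pi,
      r * (u (r • radial θ) * inner ℝ (H (r • radial θ)) (radial θ)) := by
    refine (h2 hr).trans_eq (intervalIntegral.integral_congr fun θ _ => ?_)
    simp only [normalField_polar hr.1]
  have h4' := h4 hr
  have h5' := h5 hr
  have h6' := h6 hr
  simp only [normalField_polar hr.1] at h4'
  simp only [tangentField_polar hr.1] at h5' h6'
  refine ⟨?_, fun hz => ?_⟩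
  · by_contra! hcon
    have hz : ∀ θ, u (r • radial θ) = 0 := fun θ => le_antisymm (hcon θ) (hnonneg _ (hmem θ))
    simp only [hz, zero_mul, mul_zero, intervalIntegral.integral_zero] at hq
    linarith
  obtain ⟨θ₀, hθ₀⟩ := hz
  set l := ∫ θ in (-Real.pi)..Real.pi, indicator {θ | u (r • radial θ) ≠ 0} (1 : ℝ → ℝ) θ with hl
  have hl0 : 0 ≤ l := intervalIntegral.integral_nonneg hpi fun θ _ =>
    indicator_nonneg (by simp) θ
  have hSm : MeasurableSet {θ | u (r • radial θ) ≠ 0} :=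
    (isOpen_ne_fun hw continuous_const).measurableSet
  have hlpos : 0 < l := by
    refine lt_of_le_of_ne hl0 fun hl00 => ?_
    -- If `u` vanished almost everywhere on the circle, there would be no flux.
    have hi : IntegrableOn ({θ | u (r • radial θ) ≠ 0}.indicator (1 : ℝ → ℝ))
        (Ioc (-Real.pi) Real.pi) := IntegrableOn.indicator (integrableOn_const (by simp)) hSm
    rw [hl, intervalIntegral.integral_of_le hpi, eq_comm, setIntegral_eq_zero_iff_of_nonneg_ae
      (.of_forall fun θ => indicator_nonneg (by simp) θ) hi] at hl00
    have hq0 : ∫ θ in (-Real.pi)..Real.pi,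
        r * (u (r • radial θ) * inner ℝ (H (r • radial θ)) (radial θ)) = 0 := by
      rw [intervalIntegral.integral_of_le hpi]
      refine integral_eq_zero_of_ae ?_
      filter_upwards [hl00] with θ hθ
      by_cases hu0 : u (r • radial θ) = 0
      · simp [hu0]
      · rw [indicator_of_mem (show θ ∈ {θ | u (r • radial θ) ≠ 0} from hu0)] at hθ
        simp at hθ
    linarith
  refine ⟨hlpos, le_trans ?_ (mul_flux_le_energy hlam hL hr.1 (hper u) ?_ hw h5' h6' (h3 hr) h4'
    (h1 hr) ?_ hθ₀ hl hlpos)⟩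
  · have hk : 0 ≤ 2 * √(lam / L) * (Real.pi / (l * r)) := by
      have := hr.1
      positivity
    exact mul_le_mul_of_nonneg_left hq hk
  · intro θ
    simp only [radial_periodic θ, tangent_periodic θ]
  · filter_upwards [h7 hr.1, h8 hr.1, h9 hr.1] with θ g1 g2 g3 hθ
    exact conormal_sq_add_tangential_sq_le (g1 hθ) hlam hL (g2 hθ) (g3 hθ) (norm_radial θ)
      (norm_tangent θ) (inner_radial_tangent θ) _

/-! ### The monotonicity formula -/

theorem theorem1p1 {lam L : ℝ} (hlam : 0 < lam) (hL : lam ≤ L)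
    {A : EuclideanSpace ℝ (Fin 2) → Matrix (Fin 2) (Fin 2) ℝ}
    (hA : MemEllipticClass lam L A)
    {m : ℕ} (hm : 2 ≤ m)
    {u : Fin m → EuclideanSpace ℝ (Fin 2) → ℝ}
    {G : Fin m → EuclideanSpace ℝ (Fin 2) → EuclideanSpace ℝ (Fin 2)}
    (hu : ∀ i, MemH1WithGradient (Metric.ball 0 1) (u i) (G i))
    (hcont : ∀ i, ContinuousOn (u i) (Metric.ball 0 1))
    (hnonneg : ∀ i, ∀ x ∈ Metric.ball 0 1, 0 ≤ u i x)
    (hsub : ∀ i, IsWeakSubsolution A (Metric.ball 0 1) (G i))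
    (hdisj : ∀ i j, i ≠ j →
      Disjoint {x ∈ Metric.ball 0 1 | 0 < u i x} {x ∈ Metric.ball 0 1 | 0 < u j x})
    (hzero : ∀ i, u i 0 = 0) :
    MonotoneOn (acfFunctional lam L A G) (Ioo 0 1) := by
  have hpi : -Real.pi ≤ Real.pi := by linarith [Real.pi_pos]
  set f : Fin m → ℝ → ℝ := fun i =>
    integralOnCircle (fun x => matPairing (A x) (G i x) (G i x)) with hf
  have hint : ∀ i, IntegrableOn (fun x => matPairing (A x) (G i x) (G i x)) (Metric.ball 0 1) :=
    fun i => (hA.memLp_toEuclideanLin hlam hL (hu i).memLp_grad).integrable_inner (hu i).memLp_grad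
  have hfi : ∀ i, IntervalIntegrable (f i) volume 0 1 := fun i =>
    intervalIntegrable_integralOnCircle (hint i)
  have hΦ : ∀ r ∈ Ioo (0 : ℝ) 1, acfFunctional lam L A G r =
      ∏ i, 1 / r ^ (2 * acfExponent m lam L) * ∫ s in (0)..r, f i s := fun r hr => by
    simp only [acfFunctional]
    exact Finset.prod_congr rfl fun i _ => by
      rw [integral_ball_eq_integralOnCircle (hint i) hr.1.le hr.2.le]
  have hf0 : ∀ i, ∀ᵐ r, 0 < r → 0 ≤ f i r := fun i => by
    filter_upwards [ae_ae_polar hA.lower] with r hr hr0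
    simp only [hf, integralOnCircle_eq]
    refine setIntegral_nonneg_of_ae_restrict ?_
    rw [EventuallyLE, ae_restrict_iff' measurableSet_Ioo]
    filter_upwards [hr hr0] with θ hθ hθm
    exact mul_nonneg hr0.le (le_trans (by positivity) (hθ hθm (G i (r • radial θ))))
  have hD0 : ∀ i, ∀ r ∈ Ioo (0 : ℝ) 1, 0 ≤ ∫ s in (0)..r, f i s := fun i r hr => by
    rw [intervalIntegral.integral_of_le hr.1.le]
    refine setIntegral_nonneg_of_ae_restrict ?_
    rw [EventuallyLE, ae_restrict_iff' measurableSet_Ioc]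
    filter_upwards [hf0 i] with s hs hsm using hs hsm.1
  intro a ha b hb hab
  rw [hΦ a ha, hΦ b hb]
  -- If one energy vanishes on `B_a`, the product vanishes at `a`. Otherwise all energies stay
  -- positive on `[a, b]`.
  by_cases hpos : ∀ i, 0 < ∫ s in (0)..a, f i s
  swap
  · push Not at hpos
    obtain ⟨i, hi⟩ := hpos
    have h0 := le_antisymm hi (hD0 i a ha)
    rw [Finset.prod_eq_zero (Finset.mem_univ i) (by rw [h0, mul_zero])]
    exact Finset.prod_nonneg fun j _ =>
      mul_nonneg (one_div_nonneg.2 (Real.rpow_nonneg hb.1.le _)) (hD0 j b hb)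
  have hfb : ∀ i, ∀ x ∈ Icc a b, ∀ y ∈ Icc 0 b, IntervalIntegrable (f i) volume y x :=
    fun i x hx y hy => (hfi i).mono_set (uIcc_subset_uIcc
      (by rw [uIcc_of_le zero_le_one]; exact ⟨hy.1, hy.2.trans hb.2.le⟩)
      (by rw [uIcc_of_le zero_le_one]; exact ⟨ha.1.le.trans hx.1, hx.2.trans hb.2.le⟩))
  refine prod_div_rpow_le_of_le_sum_div ha.1 hab
    (fun i => hfb i b ⟨hab, le_rfl⟩ 0 ⟨le_rfl, hb.1.le⟩)
    (fun i => (hf0 i).mono fun x hx hxm => hx (ha.1.trans_le hxm.1)) hpos ?_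
  have hrate := ae_all_iff.2 fun i =>
    ae_mul_energy_le_integralOnCircle hlam hL hA (hu i) (hcont i) (hnonneg i) (hsub i)
  filter_upwards [hrate] with r hr hrab
  have hr01 : r ∈ Ioo (0 : ℝ) 1 := ⟨ha.1.trans_le hrab.1, hrab.2.trans_lt hb.2⟩
  have hmem : ∀ θ, r • radial θ ∈ Metric.ball (0 : Plane) 1 := fun θ => by
    rw [mem_ball_zero_iff, norm_smul_radial hr01.1.le]; exact hr01.2
  have hDr : ∀ i, 0 < ∫ s in (0)..r, f i s := fun i => by
    have h1 : (∫ s in (0)..a, f i s) + ∫ s in a..r, f i s = ∫ s in (0)..r, f i s :=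
      intervalIntegral.integral_add_adjacent_intervals
        (hfb i a ⟨le_rfl, hab⟩ 0 ⟨le_rfl, hb.1.le⟩) (hfb i r hrab a ⟨ha.1.le, hab⟩)
    have h2 : 0 ≤ ∫ s in a..r, f i s := by
      rw [intervalIntegral.integral_of_le hrab.1]
      refine setIntegral_nonneg_of_ae_restrict ?_
      rw [EventuallyLE, ae_restrict_iff' measurableSet_Ioc]
      filter_upwards [hf0 i] with s hs hsm using hs (ha.1.trans hsm.1)
    linarith [hpos i]
  have hexcl : ∀ i j, i ≠ j → ∀ θ, 0 < u i (r • radial θ) → u j (r • radial θ) = 0 := by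
    intro i j hij θ hi
    by_contra hj
    exact disjoint_left.1 (hdisj i j hij) ⟨hmem θ, hi⟩
      ⟨hmem θ, lt_of_le_of_ne (hnonneg j _ (hmem θ)) (Ne.symm hj)⟩
  -- As `m ≥ 2`, another function is positive somewhere on the circle, and `u j` vanishes there.
  have hz : ∀ j, ∃ θ, u j (r • radial θ) = 0 := fun j => by
    have : Nontrivial (Fin m) := Fin.nontrivial_iff_two_le.2 hm
    obtain ⟨i, hij⟩ := exists_ne j
    obtain ⟨θ, hθ⟩ := (hr i hr01 (hDr i)).1
    exact ⟨θ, hexcl i j hij θ hθ⟩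
  set l : Fin m → ℝ := fun i =>
    ∫ θ in (-Real.pi)..Real.pi, indicator {θ | u i (r • radial θ) ≠ 0} (1 : ℝ → ℝ) θ with hl
  have hlpos : ∀ i, 0 < l i := fun i => ((hr i hr01 (hDr i)).2 (hz i)).1
  have hlsum : ∑ i, l i ≤ 2 * Real.pi := by
    have hi : ∀ i, IntervalIntegrable (indicator {θ | u i (r • radial θ) ≠ 0} (1 : ℝ → ℝ)) volume
        (-Real.pi) Real.pi := fun i => by
      rw [intervalIntegrable_iff]
      refine IntegrableOn.indicator (integrableOn_const (by simp [uIoc])) ?_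
      exact (isOpen_ne_fun ((hcont i).comp_continuous (continuous_radial.const_smul r) hmem)
        continuous_const).measurableSet
    rw [hl, ← intervalIntegral.integral_finsetSum fun i _ => hi i]
    calc _ ≤ ∫ θ in (-Real.pi)..Real.pi, (1 : ℝ) := by
          refine intervalIntegral.integral_mono_on hpi
            (by simpa only [Finset.sum_fn] using IntervalIntegrable.sum Finset.univ fun i _ => hi i)
            intervalIntegrable_const fun θ _ => ?_
          by_cases h : ∃ i, u i (r • radial θ) ≠ 0
          · obtain ⟨i, hui⟩ := h
            rw [Finset.sum_eq_single i]
            · exact indicator_le_self' (by simp) θ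
            · intro j _ hji
              refine indicator_of_notMem (not_not.2 ?_) _
              exact hexcl i j hji.symm θ (lt_of_le_of_ne (hnonneg i _ (hmem θ)) hui.symm)
            · simp
          · push Not at h
            simp [h]
      _ = 2 * Real.pi := by simp; ring
  have : Nonempty (Fin m) := ⟨⟨0, by omega⟩⟩
  have hsum := sq_card_le_sum_pi_div hlpos hlsum
  have hterm : ∀ i, 2 * √(lam / L) / r * (Real.pi / l i) ≤ f i r / ∫ s in (0)..r, f i s := by
    intro i
    rw [le_div_iff₀ (hDr i)]
    refine le_of_eq_of_le ?_ ((hr i hr01 (hDr i)).2 (hz i)).2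
    change _ = 2 * √(lam / L) * (Real.pi / (l i * r)) * ∫ s in (0)..r, f i s
    have := (hlpos i).ne'
    have := hr01.1.ne'
    field_simp
  calc Fintype.card (Fin m) * (2 * acfExponent m lam L) / r
      = 2 * √(lam / L) / r * ((Fintype.card (Fin m) : ℝ) ^ 2 / 2) := by
        rw [acfExponent, Fintype.card_fin]; ring
    _ ≤ 2 * √(lam / L) / r * ∑ i, Real.pi / l i := by
        have := hr01.1
        gcongr
    _ = ∑ i, 2 * √(lam / L) / r * (Real.pi / l i) := Finset.mul_sum _ _ _
    _ ≤ ∑ i, f i r / ∫ s in (0)..r, f i s := Finset.sum_le_sum fun i _ => hterm i
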